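/- Let $\mu,\nu\ge 0$ be integers with $\mu-\nu\ge 0$, and let $n\ge 1$ be an integer. Let $J_\nu$ and $K_\nu$ denote the Bessel function of the first kind and the modified Bessel function of the second kind, and for $x>0$ put $$w_{\mu,\nu}(x)=\tfrac12 K_\nu(\sqrt{x})\,x^{(\mu-1)/2}\ \text{ if }\mu-\nu\text{ is even},\qquad w_{\mu,\nu}(x)=\tfrac12 K_\nu(\sqrt{x})\,x^{\mu/2}\ \text{ if }\mu-\nu\text{ is odd}.$$ Let $\phi_0,\phi_1,\dots$ be the monic orthogonal polynomials for the weight $w_{\mu,\nu}$ on $(0,\infty)$, let $\tau_m=\int_0^\infty w_{\mu,\nu}\phi_m^2\,dx$, and let $x_1,\dots,x_n$ be the zeros of $\phi_n$ and $w_j=\tau_{n-1}/(\phi_n'(x_j)\phi_{n-1}(x_j))$, i.e. $\{x_j,w_j\}_{j=1}^n$ are the nodes and weights of the $n$-point Gaussian quadrature rule for $w_{\mu,\nu}$; one has $x_j>0$. Let $\kappa=\mu$ if $\mu-\nu$ is even and $\kappa=\mu+1$ if $\mu-\nu$ is odd. For $0\le k\le\mu-1$ put $$\hat w_k^0=\frac1{k!}\left(2^k\,\frac{\Gamma((\nu+k+1)/2)}{\Gamma((\nu-k+1)/2)}-\frac2\pi\cos\!\left(\frac{(k-\nu)\pi}{2}\right)\sum_{j=1}^n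 w_j\,x_j^{(k-\kappa)/2}\right),$$ where $1/\Gamma$ is $0$ at the poles of $\Gamma$, and define $$(\mathcal Q^{\mathrm{HI}}_{2n,\mu}f)(\omega)=\frac1\omega\left(\sum_{k=0}^{\mu-1}\frac{\hat w_k^0}{\omega^k}f^{(k)}(0)+\sum_{j=1}^n\frac{w_jx_j^{-\kappa/2}}{\pi}\left(e^{-\nu\pi i/2}f\!\left(\frac{i\sqrt{x_j}}{\omega}\right)+e^{\nu\pi i/2}f\!\left(-\frac{i\sqrt{x_j}}{\omega}\right)\right)\right).$$ Suppose that $f$ is analytic in the right half-plane $\{\operatorname{Re}z>0\}$ and analytic at $z=0$, and that for some $\sigma\in\mathbb R$ and some constant $\mathcal K$ one has $|f(z)|\le\mathcal K|z|^\sigma$ for all $z$ with $\operatorname{Re}z>0$ and $|z|$ sufficiently large. Then for every $\omega>0$ the Hankel transform $$(\mathcal H_\nu f)(\omega)=\int_0^\infty f(x)J_\nu(\omega x)\,dx:=\lim_{s\to0^+}\int_0^\infty f(x)J_\nu(\omega x)e^{-sx}\,dx$$ exists as an Abel limit (the integrals on the right converge absolutely for every $s>0$), and as $\omega\to\infty$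 $$(\mathcal H_\nu f)(\omega)-(\mathcal Q^{\mathrm{HI}}_{2n,\mu}f)(\omega)=\begin{cases}O(\omega^{-4n-\mu-1}),&\mu-\nu\text{ even},\\ O(\omega^{-4n-\mu-2}),&\mu-\nu\text{ odd}.\end{cases}$$ -/

import Mathlib

open Set Filter Topology MeasureTheory Polynomial Asymptotics

namespace HankelQuadrature

noncomputable section

/-- The Bessel function of the first kind `J_ν(x)` of integer order `ν ≥ 0`, by Bessel's integral
`J_ν(x) = (1/π) ∫₀^π cos(νθ - x sin θ) dθ`. -/
def besselJ (ν : ℕ) (x : ℝ) : ℝ :=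
  (1 / Real.pi) * ∫ θ in (0 : ℝ)..Real.pi, Real.cos (ν * θ - x * Real.sin θ)

/-- The modified Bessel function of the second kind `K_ν(x)` of integer order `ν ≥ 0`, for `x > 0`:
`K_ν(x) = (1/2) (x/2)^ν ∫₀^∞ exp(-t - x²/(4t)) t^{-ν-1} dt`. -/
def besselK (ν : ℕ) (x : ℝ) : ℝ :=
  (1 / 2) * (x / 2) ^ ν * ∫ t in Ioi (0 : ℝ), Real.exp (-t - x ^ 2 / (4 * t)) / t ^ (ν + 1)

/-- `I` is the Abel limit of the improper integral `∫₀^∞ g(x) dx`: for each `s > 0` the function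
`g(x) e^{-sx}` is integrable on `(0, ∞)`, and `∫₀^∞ g(x) e^{-sx} dx → I` as `s → 0⁺`. -/
def HasAbelIntegral (g : ℝ → ℂ) (I : ℂ) : Prop :=
  (∀ s : ℝ, 0 < s → IntegrableOn (fun x : ℝ => g x * (Real.exp (-s * x) : ℂ)) (Ioi 0)) ∧
    Tendsto (fun s : ℝ => ∫ x in Ioi (0 : ℝ), g x * (Real.exp (-s * x) : ℂ)) (𝓝[>] 0) (𝓝 I)

/-- The value of the Abel limit of `∫₀^∞ g(x) dx` (meaningful when `HasAbelIntegral g I` holds for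
some `I`, and then equal to that `I`). -/
def abelIntegral (g : ℝ → ℂ) : ℂ :=
  limUnder (𝓝[>] (0 : ℝ)) fun s : ℝ => ∫ x in Ioi (0 : ℝ), g x * (Real.exp (-s * x) : ℂ)

/-- The integrand `f(x) J_ν(ωx)` of the Hankel transform. -/
def hankelIntegrand (ν : ℕ) (f : ℂ → ℂ) (ω : ℝ) (x : ℝ) : ℂ :=
  f (x : ℂ) * (besselJ ν (ω * x) : ℂ)

/-- The Hankel transform `(H_ν f)(ω) = ∫₀^∞ f(x) J_ν(ωx) dx`, as an Abel limit. -/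
def hankelTransform (ν : ℕ) (f : ℂ → ℂ) (ω : ℝ) : ℂ :=
  abelIntegral (hankelIntegrand ν f ω)

/-- The monic orthogonal polynomials `φ₀, φ₁, …` for the weight `w` on `(0, ∞)`, by the Gram–Schmidt
procedure applied to `1, x, x², …`:
`φ_n = xⁿ - ∑_{m < n} (∫ w xⁿ φ_m / ∫ w φ_m²) φ_m`. -/
def orthoPoly (w : ℝ → ℝ) : ℕ → ℝ[X]
  | n => X ^ n - ∑ m : Fin n,
      C ((∫ x in Ioi (0 : ℝ), w x * (x ^ n * (orthoPoly w m).eval x)) /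
          (∫ x in Ioi (0 : ℝ), w x * (orthoPoly w m).eval x ^ 2)) * orthoPoly w m
termination_by n => n
decreasing_by all_goals exact m.isLt

/-- `τ_n = ∫₀^∞ w(x) φ_n(x)² dx`. -/
def orthoNorm (w : ℝ → ℝ) (n : ℕ) : ℝ :=
  ∫ x in Ioi (0 : ℝ), w x * (orthoPoly w n).eval x ^ 2

/-- The nodes of the `n`-point Gaussian quadrature rule for `w` on `(0, ∞)`: the zeros of `φ_n`. -/
def gaussNodes (w : ℝ → ℝ) (n : ℕ) : Finset ℝ :=
  (orthoPoly w n).roots.toFinset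

/-- The weight of the `n`-point Gaussian quadrature rule (`n ≥ 1`) at the node `x`:
`τ_{n-1} / (φ_n'(x) φ_{n-1}(x))`. -/
def gaussWeight (w : ℝ → ℝ) (n : ℕ) (x : ℝ) : ℝ :=
  orthoNorm w (n - 1) /
    ((derivative (orthoPoly w n)).eval x * (orthoPoly w (n - 1)).eval x)

/-- The weight function `w_{μ,ν}` on `(0, ∞)`, for `ν ≤ μ`: `x^{(μ-1)/2} K_ν(√x) / 2` if `μ - ν` is
even and `x^{μ/2} K_ν(√x) / 2` if `μ - ν` is odd. -/
def weightFun (μ ν : ℕ) (x : ℝ) : ℝ :=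
  besselK ν (Real.sqrt x) / 2 *
    if Even (μ - ν) then x ^ (((μ : ℝ) - 1) / 2) else x ^ ((μ : ℝ) / 2)

/-- `κ = μ` if `μ - ν` is even, and `κ = μ + 1` if `μ - ν` is odd (for `ν ≤ μ`). -/
def kappa (μ ν : ℕ) : ℝ :=
  if Even (μ - ν) then (μ : ℝ) else (μ : ℝ) + 1

/-- The weight at the endpoint `0` of the quadrature rule:
`(1/k!) (2^k Γ((ν+k+1)/2) / Γ((ν-k+1)/2) - (2/π) cos((k-ν)π/2) ∑_j w_j x_j^{(k-κ)/2})`.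
Here `1/Γ` is read as `0` at the poles of `Γ`; this agrees with Lean's values, because `Real.Gamma`
vanishes at the poles and division by zero gives zero. -/
def boundaryWeight (n μ ν k : ℕ) : ℝ :=
  (1 / (k.factorial : ℝ)) *
    (2 ^ k * (Real.Gamma (((ν : ℝ) + k + 1) / 2) / Real.Gamma (((ν : ℝ) - k + 1) / 2)) -
      (2 / Real.pi) * Real.cos (((k : ℝ) - ν) * Real.pi / 2) *
        ∑ x ∈ gaussNodes (weightFun μ ν) n,
          gaussWeight (weightFun μ ν) n x * x ^ (((k : ℝ) - kappa μ ν) / 2))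

/-- The quadrature rule `(Q_{2n,μ} f)(ω)`: the endpoint part uses `f(0), …, f^{(μ-1)}(0)`, and each
Gaussian node `x_j` gives the two nodes `± i √x_j` with weights
`exp(∓ νπi/2) w_j x_j^{-κ/2} / π`. -/
def quadRule (n μ ν : ℕ) (f : ℂ → ℂ) (ω : ℝ) : ℂ :=
  (1 / (ω : ℂ)) *
    ((∑ k ∈ Finset.range μ, ((boundaryWeight n μ ν k : ℂ) / (ω : ℂ) ^ k) * iteratedDeriv k f 0) +
      ∑ x ∈ gaussNodes (weightFun μ ν) n,
        ((gaussWeight (weightFun μ ν) n x * x ^ (-kappa μ ν / 2) / Real.pi : ℝ) : ℂ) *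
          (Complex.exp (-(ν * Real.pi * Complex.I / 2)) *
              f (Complex.I * (Real.sqrt x : ℂ) / (ω : ℂ)) +
            Complex.exp (ν * Real.pi * Complex.I / 2) *
              f (-(Complex.I * (Real.sqrt x : ℂ)) / (ω : ℂ))))

end

end HankelQuadrature

open HankelQuadrature

namespace HankelQuadrature

/-! Both `hankelTransform` and `quadRule` have an expansion in powers of `1/ω` whose coefficients
are Taylor coefficients of `f` at `0` times numbers independent of `f`. With `κ = ν + 2d` (so `κ =
μ` or `κ = μ + 1`), the first `κ + 4n` terms agree and both remainders are `O(ω^(-κ-4n-1))`; this is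
the claimed order in either parity.

For the transform, write `J_ν(x)` as a contour integral of `exp(-x q(z)) z^(-ν-1)`, `q =
besselPhase`, over a circle on which `Re q ≥ 0`, vanishing only at `±i`, and on which `|q|` is
bounded below. By Fubini the damped integral becomes a contour integral of the Laplace transform of
`f` at `s + ω q(z)`, and dominated convergence gives the limit `s → 0⁺`
(`HankelAdmissible.hasAbelIntegral`). Watson's lemma, uniform on the right half plane away from `0`
(`HankelAdmissible.laplace_expansion`), then yields `HankelAdmissible.hankelTransform_expansion`.
Its coefficients are contour integrals of powers of `1/q`; exact derivatives on the circle give a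
recurrence that identifies them with Gamma quotients (`phaseMoment_eq_Gamma`).

For the rule, the nodes `±i√x_j/ω` tend to `0`, so `f` may be replaced by its Taylor polynomial. The
monomial `z^k` then contributes `(2/π) cos((k-ν)π/2) ∑ w_j x_j^((k-κ)/2)`. For `k < μ` the boundary
weights are exactly the defect from the Abel moment of `J_ν`. For `μ ≤ k < κ + 4n` there is no
defect: if `k - ν` is odd both sides vanish, and if `k = κ + 2l` the reflection formula turns the
Abel moment into the `l`-th moment of the weight (`besselMoment_eq_integral`), which the Gaussian
rule integrates exactly because `l < 2n`. This is `besselMoment_eq_gaussSum`, the heart of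
`quadRule_expansion`. -/

/-! ### Contour representation of the Bessel function -/

/-- Integrals of Laurent polynomials do not depend on the circle around the origin. -/
theorem circleIntegral_laurent_eq {c : ℂ} {R : ℝ} (h0 : (0 : ℂ) ∈ Metric.ball c R) (m : ℕ) (j : ℤ) :
    (∮ z in C(c, R), (z - z⁻¹) ^ m * z ^ j) = ∮ z in C(0, 1), (z - z⁻¹) ^ m * z ^ j := by
  have hR : 0 < R := lt_of_le_of_lt dist_nonneg (Metric.mem_ball.1 h0)
  have key : ∀ {c : ℂ} {R : ℝ}, (0 : ℂ) ∈ Metric.ball c R → ∀ (m : ℕ) (j : ℤ),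
      CircleIntegrable (fun z : ℂ => (z - z⁻¹) ^ m * z ^ j) c R := by
    intro c R h0 m j
    have hR : 0 < R := lt_of_le_of_lt dist_nonneg (Metric.mem_ball.1 h0)
    refine ContinuousOn.circleIntegrable hR.le ?_
    have hne : ∀ z ∈ Metric.sphere c R, z ≠ 0 := by
      rintro z hz rfl
      rw [Metric.mem_sphere] at hz
      rw [Metric.mem_ball, hz] at h0
      exact lt_irrefl _ h0
    refine ContinuousOn.mul (ContinuousOn.pow (continuousOn_id.sub
      (continuousOn_id.inv₀ hne)) _) (fun z hz => ?_)
    exact (continuousAt_zpow₀ z j (Or.inl (hne z hz))).continuousWithinAt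
  have h01 : (0 : ℂ) ∈ Metric.ball (0 : ℂ) 1 := by simp
  induction m generalizing j with
  | zero =>
    simp only [pow_zero, one_mul]
    by_cases hj : j = -1
    · subst hj
      simp only [zpow_neg_one]
      have := circleIntegral.integral_sub_inv_of_mem_ball h0
      have h2 := circleIntegral.integral_sub_inv_of_mem_ball h01
      simp only [sub_zero] at this h2
      rw [this, h2]
    · have := circleIntegral.integral_sub_zpow_of_ne hj c 0 R
      have h2 := circleIntegral.integral_sub_zpow_of_ne hj 0 0 1
      simp only [sub_zero] at this h2
      rw [this, h2]
  | succ m ih =>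
    -- One factor `z - z⁻¹` splits into shifts of the exponent `j` by `±1`, which is why the
    -- induction runs over all `j`.
    have aux : ∀ {c : ℂ} {R : ℝ}, (0 : ℂ) ∈ Metric.ball c R →
        (∮ z in C(c, R), (z - z⁻¹) ^ (m + 1) * z ^ j) =
        (∮ z in C(c, R), (z - z⁻¹) ^ m * z ^ (j + 1)) -
        ∮ z in C(c, R), (z - z⁻¹) ^ m * z ^ (j - 1) := by
      intro c R h0
      have hR : 0 < R := lt_of_le_of_lt dist_nonneg (Metric.mem_ball.1 h0)
      rw [← circleIntegral.integral_sub (key h0 _ _) (key h0 _ _)]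
      refine circleIntegral.integral_congr hR.le fun z hz => ?_
      have hz0 : z ≠ 0 := by
        rintro rfl
        rw [Metric.mem_sphere] at hz
        rw [Metric.mem_ball, hz] at h0
        exact lt_irrefl _ h0
      simp only [zpow_add_one₀ hz0, zpow_sub_one₀ hz0]
      ring
    rw [aux h0, aux h01, ih, ih]

/-- The generating function of the Bessel functions may be integrated over any circle around `0`. -/
theorem circleIntegral_exp_laurent_eq {c : ℂ} {R : ℝ} (h0 : (0 : ℂ) ∈ Metric.ball c R) (x : ℂ)
    (j : ℤ) :
    (∮ z in C(c, R), Complex.exp (x * (z - z⁻¹)) * z ^ j) =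
      ∮ z in C(0, 1), Complex.exp (x * (z - z⁻¹)) * z ^ j := by
  -- The two circles need not be concentric. Expanding the exponential and integrating termwise
  -- reduces the claim to Laurent polynomials; compactness of the circle gives an exponential series
  -- as dominating sum.
  have key : ∀ {c : ℂ} {R : ℝ}, (0 : ℂ) ∈ Metric.ball c R →
      HasSum (fun m : ℕ => (x ^ m / m.factorial) * ∮ z in C(c, R), (z - z⁻¹) ^ m * z ^ j)
        (∮ z in C(c, R), Complex.exp (x * (z - z⁻¹)) * z ^ j) := by
    intro c R h0
    have hR : 0 < R := lt_of_le_of_lt dist_nonneg (Metric.mem_ball.1 h0)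
    have hne : ∀ z ∈ Metric.sphere c R, z ≠ 0 := by
      rintro z hz rfl
      rw [Metric.mem_sphere] at hz
      rw [Metric.mem_ball, hz] at h0
      exact lt_irrefl _ h0
    have hθ : ∀ θ, circleMap c R θ ≠ 0 := fun θ => hne _ (circleMap_mem_sphere c hR.le θ)
    have hc1 : Continuous fun θ => circleMap c R θ - (circleMap c R θ)⁻¹ :=
      (continuous_circleMap c R).sub ((continuous_circleMap c R).inv₀ hθ)
    have hc2 : Continuous fun θ => circleMap c R θ ^ j :=
      (continuous_circleMap c R).zpow₀ j fun θ => Or.inl (hθ θ)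
    have hc3 : Continuous fun θ => deriv (circleMap c R) θ := by
      simp only [deriv_circleMap]
      exact (continuous_circleMap 0 R).mul continuous_const
    obtain ⟨B, hB⟩ := isCompact_uIcc.exists_bound_of_continuousOn
      (s := uIcc (0 : ℝ) (2 * Real.pi)) hc1.continuousOn
    obtain ⟨D, hD⟩ := isCompact_uIcc.exists_bound_of_continuousOn
      (f := fun θ => deriv (circleMap c R) θ * circleMap c R θ ^ j)
      (s := uIcc (0 : ℝ) (2 * Real.pi)) (hc3.mul hc2).continuousOn
    have hsum : HasSum (fun m : ℕ => ∫ θ in (0 : ℝ)..2 * Real.pi,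
        deriv (circleMap c R) θ • ((x ^ m / m.factorial) *
          ((circleMap c R θ - (circleMap c R θ)⁻¹) ^ m * circleMap c R θ ^ j)))
        (∫ θ in (0 : ℝ)..2 * Real.pi, deriv (circleMap c R) θ •
          (Complex.exp (x * (circleMap c R θ - (circleMap c R θ)⁻¹)) * circleMap c R θ ^ j)) := by
      refine intervalIntegral.hasSum_integral_of_dominated_convergence
        (fun m _ => D * ((‖x‖ * B) ^ m / m.factorial)) (fun m => ?_) (fun m => ?_) ?_ ?_ ?_
      · refine Continuous.aestronglyMeasurable ?_
        exact hc3.smul (continuous_const.mul ((hc1.pow m).mul hc2))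
      · refine Eventually.of_forall fun θ hθ' => ?_
        have h1 := hB θ (uIoc_subset_uIcc hθ')
        have h2 := hD θ (uIoc_subset_uIcc hθ')
        have : deriv (circleMap c R) θ • ((x ^ m / m.factorial) *
          ((circleMap c R θ - (circleMap c R θ)⁻¹) ^ m * circleMap c R θ ^ j)) =
          (deriv (circleMap c R) θ * circleMap c R θ ^ j) *
            ((x * (circleMap c R θ - (circleMap c R θ)⁻¹)) ^ m / m.factorial) := by
          rw [smul_eq_mul, mul_pow]; ring
        have hD0 : 0 ≤ D := (norm_nonneg _).trans h2
        have h3 : ‖x * (circleMap c R θ - (circleMap c R θ)⁻¹)‖ ≤ ‖x‖ * B := by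
          rw [norm_mul]; gcongr
        rw [this, norm_mul, norm_div, norm_pow, Complex.norm_natCast]
        gcongr
      · exact Eventually.of_forall fun θ _ =>
          (Real.summable_pow_div_factorial (‖x‖ * B)).mul_left D
      · exact continuous_const.intervalIntegrable _ _
      · refine Eventually.of_forall fun θ _ => ?_
        have h := NormedSpace.expSeries_div_hasSum_exp (𝔸 := ℂ)
          (x * (circleMap c R θ - (circleMap c R θ)⁻¹))
        rw [← Complex.exp_eq_exp_ℂ] at h
        have := h.mul_left (deriv (circleMap c R) θ * circleMap c R θ ^ j)
        convert! this using 1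
        · ext m; rw [smul_eq_mul, mul_pow]; ring
        · rw [smul_eq_mul]; ring
    convert! hsum using 2 with m
    rw [← circleIntegral.integral_const_mul]
    rfl
  have h1 := key h0
  have h2 := key (show (0 : ℂ) ∈ Metric.ball (0 : ℂ) 1 by simp)
  simp only [circleIntegral_laurent_eq h0] at h1
  exact h1.unique h2

/-- On `z = e^{iθ}` one has `z - z⁻¹ = 2i sin θ`. Since `ν` is an integer the integrand has period
`2π`, so the second half of the circle reflects onto `[0, π]`, and the two halves add up to a
cosine. -/
theorem besselJ_eq_circleIntegral_unit (ν : ℕ) (x : ℝ) :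
    (besselJ ν x : ℂ) = (2 * Real.pi * Complex.I)⁻¹ *
      ∮ z in C(0, 1), Complex.exp (x / 2 * (z - z⁻¹)) * z ^ (-(ν : ℤ) - 1) := by
  have hpi : (Real.pi : ℂ) ≠ 0 := by exact_mod_cast Real.pi_ne_zero
  set h : ℝ → ℂ := fun θ => Complex.exp (((ν * θ - x * Real.sin θ : ℝ) : ℂ) * Complex.I) with hh
  have hcont : Continuous h := by rw [hh]; fun_prop
  have e1 : (∮ z in C(0, 1), Complex.exp (x / 2 * (z - z⁻¹)) * z ^ (-(ν : ℤ) - 1)) =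
      ∫ θ in (0 : ℝ)..2 * Real.pi, Complex.I * h (-θ) := by
    unfold circleIntegral
    refine intervalIntegral.integral_congr fun θ _ => ?_
    have hz : circleMap 0 1 θ = Complex.exp (θ * Complex.I) := by simp [circleMap]
    have hsin : Complex.exp (θ * Complex.I) - (Complex.exp (θ * Complex.I))⁻¹ =
        2 * Real.sin θ * Complex.I := by
      rw [← Complex.exp_neg, ← neg_mul, Complex.ofReal_sin, Complex.sin]
      linear_combination (-(Complex.exp (-θ * Complex.I)) + Complex.exp (θ * Complex.I)) *
        Complex.I_sq
    simp only [deriv_circleMap, hz, hsin, smul_eq_mul, hh, ← Complex.exp_int_mul]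
    rw [mul_comm (Complex.exp _) Complex.I, mul_assoc, ← Complex.exp_add, ← Complex.exp_add]
    congr 2
    push_cast
    rw [Complex.sin_neg]
    ring
  have e2 : (∫ θ in (0 : ℝ)..2 * Real.pi, h (-θ)) = ∫ θ in (0 : ℝ)..2 * Real.pi, h θ := by
    have := intervalIntegral.integral_comp_sub_left (fun θ => h (-θ)) (2 * Real.pi)
      (a := 0) (b := 2 * Real.pi)
    rw [sub_self, sub_zero] at this
    rw [← this]
    refine intervalIntegral.integral_congr fun θ _ => ?_
    simp only [hh]
    rw [Complex.exp_eq_exp_iff_exists_int]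
    refine ⟨-ν, ?_⟩
    rw [neg_sub, Real.sin_sub_two_pi]
    push_cast
    ring
  have e3 : (∫ θ in (0 : ℝ)..2 * Real.pi, h (-θ)) =
      (∫ θ in (0 : ℝ)..Real.pi, h θ) + ∫ θ in (0 : ℝ)..Real.pi, h (-θ) := by
    rw [e2, ← intervalIntegral.integral_add_adjacent_intervals (b := Real.pi)
      (hcont.intervalIntegrable _ _) (hcont.intervalIntegrable _ _)]
    congr 1
    have := intervalIntegral.integral_comp_sub_left (fun θ => h θ) (2 * Real.pi)
      (a := 0) (b := Real.pi)
    rw [sub_zero, show 2 * Real.pi - Real.pi = Real.pi by ring] at this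
    rw [← this]
    refine intervalIntegral.integral_congr fun θ _ => ?_
    simp only [hh]
    rw [Complex.exp_eq_exp_iff_exists_int]
    refine ⟨ν, ?_⟩
    rw [Real.sin_two_pi_sub, Real.sin_neg]
    push_cast
    ring
  rw [e1, intervalIntegral.integral_const_mul, e3, ← intervalIntegral.integral_add
    (hcont.intervalIntegrable _ _) 
    ((show Continuous fun θ => h (-θ) from hcont.comp continuous_neg).intervalIntegrable _ _)]
  have e4 : (∫ θ in (0 : ℝ)..Real.pi, (h θ + h (-θ))) =
      2 * ((∫ θ in (0 : ℝ)..Real.pi, Real.cos (ν * θ - x * Real.sin θ) : ℝ) : ℂ) := by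
    rw [← intervalIntegral.integral_ofReal, ← intervalIntegral.integral_const_mul]
    refine intervalIntegral.integral_congr fun θ _ => ?_
    simp only [hh]
    rw [Complex.ofReal_cos, Complex.cos, Real.sin_neg]
    push_cast
    ring_nf
  rw [e4, besselJ]
  push_cast
  field_simp

/-! ### The phase on the steep circle -/

/-- `J_ν(x)` is the integral of `exp (-x * besselPhase z) * z ^ (-ν - 1)` around the origin. -/
noncomputable def besselPhase (z : ℂ) : ℂ := (z⁻¹ - z) / 2

/-- A circle around the origin on which `besselPhase` has nonnegative real part. -/
def steepCircle : Set ℂ := Metric.sphere (-3 / 4) (5 / 4)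

/-- The circle meets the imaginary axis at `±i` and the real axis at `-2` and `1/2`. Of the zeros
`±1` of `besselPhase` it encloses `-1` and excludes `1`; it also encloses the pole `0`. -/
theorem steepCircle_normSq {z : ℂ} (hz : z ∈ steepCircle) :
    Complex.normSq z = 1 - 3 / 2 * z.re := by
  have h : ‖z - (-3 / 4)‖ = 5 / 4 := mem_sphere_iff_norm.1 hz
  have h2 : Complex.normSq (z - (-3 / 4)) = (5 / 4) ^ 2 := by rw [Complex.normSq_eq_norm_sq, h]
  have e1 : ((-3 / 4 : ℂ)).re = -3 / 4 := by norm_num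
  have e2 : ((-3 / 4 : ℂ)).im = 0 := by norm_num
  rw [Complex.normSq_apply, Complex.sub_re, Complex.sub_im, e1, e2] at h2
  rw [Complex.normSq_apply]
  nlinarith

theorem steepCircle_norm_le {z : ℂ} (hz : z ∈ steepCircle) : ‖z‖ ≤ 2 := by
  have h : ‖z - (-3 / 4)‖ = 5 / 4 := mem_sphere_iff_norm.1 hz
  calc ‖z‖ = ‖(z - (-3 / 4)) + (-3 / 4)‖ := by ring_nf
    _ ≤ _ := norm_add_le _ _
    _ = 2 := by rw [h]; norm_num

theorem dist_le_norm_sub_of_mem_steepCircle {z : ℂ} (hz : z ∈ steepCircle) (w : ℂ) :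
    |5 / 4 - ‖w + 3 / 4‖| ≤ ‖z - w‖ := by
  have h : ‖z - (-3 / 4)‖ = 5 / 4 := mem_sphere_iff_norm.1 hz
  have := abs_norm_sub_norm_le (z - (-3 / 4)) (w + 3 / 4)
  rw [h] at this
  convert! this using 2
  ring

theorem half_le_norm_of_mem_steepCircle {z : ℂ} (hz : z ∈ steepCircle) : 1 / 2 ≤ ‖z‖ := by
  have := dist_le_norm_sub_of_mem_steepCircle hz 0
  norm_num at this
  linarith

theorem ne_zero_of_mem_steepCircle {z : ℂ} (hz : z ∈ steepCircle) : z ≠ 0 := by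
  have := half_le_norm_of_mem_steepCircle hz
  rintro rfl
  norm_num at this

theorem half_le_norm_sub_one {z : ℂ} (hz : z ∈ steepCircle) : 1 / 2 ≤ ‖z - 1‖ := by
  have := dist_le_norm_sub_of_mem_steepCircle hz 1
  norm_num at this
  linarith

theorem one_le_norm_add_one {z : ℂ} (hz : z ∈ steepCircle) : 1 ≤ ‖z + 1‖ := by
  have := dist_le_norm_sub_of_mem_steepCircle hz (-1)
  norm_num at this
  linarith

/-- In modulus the phase is `|z - 1| |z + 1| / (2|z|)`, and on the circle the factors are at least
`1/2` and `1` while `|z| ≤ 2`. -/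
theorem besselPhase_norm_ge {z : ℂ} (hz : z ∈ steepCircle) : 1 / 8 ≤ ‖besselPhase z‖ := by
  have h0 := ne_zero_of_mem_steepCircle hz
  have h1 := half_le_norm_sub_one hz
  have h2 := one_le_norm_add_one hz
  have h3 := steepCircle_norm_le hz
  have h4 : 0 < ‖z‖ := norm_pos_iff.2 h0
  have e : besselPhase z = -((z - 1) * (z + 1)) / (2 * z) := by
    rw [besselPhase]; field_simp; ring
  rw [e, norm_div, norm_neg, norm_mul, norm_mul, Complex.norm_ofNat, le_div_iff₀ (by positivity)]
  nlinarith

theorem besselPhase_ne_zero {z : ℂ} (hz : z ∈ steepCircle) : besselPhase z ≠ 0 := by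
  have := besselPhase_norm_ge hz
  intro h
  rw [h] at this
  norm_num at this

/-- The real part of the phase is `Re z (1 - |z|²) / (2|z|²)`, and the equation of the circle makes
`1 - |z|²` proportional to `Re z`; a perfect square results. -/
theorem besselPhase_re {z : ℂ} (hz : z ∈ steepCircle) :
    (besselPhase z).re = 3 / 4 * z.re ^ 2 / Complex.normSq z := by
  have h0 : 0 < Complex.normSq z := Complex.normSq_pos.2 (ne_zero_of_mem_steepCircle hz)
  have e : besselPhase z = ((1 / 2 : ℝ) : ℂ) * (z⁻¹ - z) := by
    rw [besselPhase]; push_cast; ring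
  rw [e, Complex.re_ofReal_mul, Complex.sub_re, Complex.inv_re]
  have := steepCircle_normSq hz
  field_simp
  rw [this]
  ring

theorem besselPhase_re_nonneg {z : ℂ} (hz : z ∈ steepCircle) : 0 ≤ (besselPhase z).re := by
  rw [besselPhase_re hz]
  have := Complex.normSq_nonneg z
  positivity

theorem besselPhase_re_pos {z : ℂ} (hz : z ∈ steepCircle) (hI : z ∉ ({Complex.I, -Complex.I} : Set ℂ)) :
    0 < (besselPhase z).re := by
  have h0 : 0 < Complex.normSq z := Complex.normSq_pos.2 (ne_zero_of_mem_steepCircle hz)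
  have h1 := steepCircle_normSq hz
  have : z.re ≠ 0 := by
    intro h
    rw [Complex.normSq_apply, h] at h1
    have h2 : (z.im - 1) * (z.im + 1) = 0 := by linarith
    apply hI
    rcases mul_eq_zero.1 h2 with h2 | h2
    · left
      exact Complex.ext (by simpa using h) (by simp; linarith)
    · right
      exact Complex.ext (by simpa using h) (by simp; linarith)
  rw [besselPhase_re hz]
  positivity

theorem zero_mem_steepBall : (0 : ℂ) ∈ Metric.ball (-3 / 4 : ℂ) (5 / 4) := by
  rw [mem_ball_iff_norm]; norm_num

theorem besselJ_eq_circleIntegral (ν : ℕ) (x : ℝ) :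
    (besselJ ν x : ℂ) = (2 * Real.pi * Complex.I)⁻¹ *
      ∮ z in C(-3 / 4, 5 / 4), Complex.exp (-(x * besselPhase z)) * z ^ (-(ν : ℤ) - 1) := by
  rw [besselJ_eq_circleIntegral_unit, ← circleIntegral_exp_laurent_eq zero_mem_steepBall]
  congr 2
  ext z
  rw [besselPhase]
  ring_nf

theorem hasDerivAt_besselPhase {z : ℂ} (hz : z ≠ 0) :
    HasDerivAt besselPhase (-(z + z⁻¹) / 2 / z) z := by
  have := ((hasDerivAt_inv hz).sub (hasDerivAt_id z)).div_const 2
  convert! this using 1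
  field_simp
  ring

theorem continuousOn_besselPhase : ContinuousOn besselPhase steepCircle := fun _ hz =>
  (hasDerivAt_besselPhase (ne_zero_of_mem_steepCircle hz)).continuousAt.continuousWithinAt

theorem continuousOn_zpow_steepCircle (j : ℤ) : ContinuousOn (fun z : ℂ => z ^ j) steepCircle :=
  fun z hz => (continuousAt_zpow₀ z j
    (Or.inl (ne_zero_of_mem_steepCircle hz))).continuousWithinAt

/-! ### Contour moments and Gamma quotients -/

/-- The contour integral giving the Abel moments of the Bessel function. -/
noncomputable def phaseMoment (j : ℤ) (k : ℕ) : ℂ :=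
  ∮ z in C(-3 / 4, 5 / 4), z ^ j * (besselPhase z ^ k)⁻¹

theorem circleIntegrable_phaseMoment (j : ℤ) (k : ℕ) :
    CircleIntegrable (fun z => z ^ j * (besselPhase z ^ k)⁻¹) (-3 / 4) (5 / 4) :=
  ContinuousOn.circleIntegrable (by norm_num) ((continuousOn_zpow_steepCircle j).mul
    ((continuousOn_besselPhase.pow k).inv₀ fun _ hz => pow_ne_zero _ (besselPhase_ne_zero hz)))

theorem circleIntegral_zpow_eq_zero {j : ℤ} (hj : j ≠ -1) :
    (∮ z in C(-3 / 4, 5 / 4), z ^ j) = 0 := by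
  simpa using circleIntegral.integral_sub_zpow_of_ne hj (-3 / 4) 0 (5 / 4)

theorem circleIntegral_inv_sub_one : (∮ z in C(-3 / 4, 5 / 4), (z - 1)⁻¹) = 0 := by
  refine Complex.circleIntegral_eq_zero_of_differentiable_on_off_countable (by norm_num)
    countable_empty ?_ ?_
  all_goals
    have : ∀ z ∈ Metric.closedBall (-3 / 4 : ℂ) (5 / 4), z - 1 ≠ 0 := by
      intro z hz h
      rw [sub_eq_zero.1 h, mem_closedBall_iff_norm] at hz
      norm_num at hz
  · exact (continuousOn_id.sub continuousOn_const).inv₀ this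
  · intro z hz
    exact (differentiableAt_id.sub_const 1).inv (this z (Metric.ball_subset_closedBall hz.1))

theorem circleIntegral_inv_add_one :
    (∮ z in C(-3 / 4, 5 / 4), (z + 1)⁻¹) = 2 * Real.pi * Complex.I := by
  have := circleIntegral.integral_sub_inv_of_mem_ball (c := -3 / 4) (w := -1) (R := 5 / 4)
    (by rw [mem_ball_iff_norm]; norm_num)
  simpa using this

theorem circleIntegrable_inv_sub {w : ℂ} (hw : w ∉ steepCircle) :
    CircleIntegrable (fun z => (z - w)⁻¹) (-3 / 4) (5 / 4) :=
  ContinuousOn.circleIntegrable (by norm_num) ((continuousOn_id.sub continuousOn_const).inv₀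
    fun z hz h => hw (by rw [← show z = w from sub_eq_zero.1 h]; exact hz))

/-- Partial fractions of `1/q` settle `ν = 0, 1`, where only the poles at `-1` and `0` contribute.
Passing from `ν` to `ν + 2` changes the integrand by a multiple of `z^(-ν-2)`, which has a
single-valued primitive. -/
theorem phaseMoment_base (ν : ℕ) :
    phaseMoment (-(ν : ℤ) - 1) 1 = 2 * Real.pi * Complex.I := by
  have i1 : CircleIntegrable (fun z : ℂ => (z - 1)⁻¹) (-3 / 4) (5 / 4) :=
    circleIntegrable_inv_sub (fun h => by have := half_le_norm_sub_one h; norm_num at this)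
  have i2 : CircleIntegrable (fun z : ℂ => (z + 1)⁻¹) (-3 / 4) (5 / 4) := by
    simpa using circleIntegrable_inv_sub (w := -1)
      (fun h => by have := one_le_norm_add_one h; norm_num at this)
  have i0 : CircleIntegrable (fun z : ℂ => z⁻¹) (-3 / 4) (5 / 4) := by
    simpa using circleIntegrable_inv_sub (w := 0) (fun h => ne_zero_of_mem_steepCircle h rfl)
  have hne1 : ∀ z ∈ steepCircle, z - 1 ≠ 0 := fun z hz h => by
    have := half_le_norm_sub_one hz
    rw [h] at this; norm_num at this
  have hne2 : ∀ z ∈ steepCircle, z + 1 ≠ 0 := fun z hz h => by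
    have := one_le_norm_add_one hz
    rw [h] at this; norm_num at this
  have hinv : ∀ z ∈ steepCircle, (besselPhase z ^ 1)⁻¹ = z * ((z + 1)⁻¹ - (z - 1)⁻¹) := by
    intro z hz
    have h0 := ne_zero_of_mem_steepCircle hz
    have h1 := hne1 z hz
    have h2 := hne2 z hz
    have e : besselPhase z = -((z - 1) * (z + 1)) / (2 * z) := by
      rw [besselPhase]; field_simp; ring
    rw [e, pow_one]
    field_simp
    ring
  induction ν using Nat.twoStepInduction with
  | zero =>
    have : phaseMoment (-((0 : ℕ) : ℤ) - 1) 1 =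
        ∮ z in C(-3 / 4, 5 / 4), ((z + 1)⁻¹ - (z - 1)⁻¹) := by
      refine circleIntegral.integral_congr (by norm_num) fun z hz => ?_
      have h0 := ne_zero_of_mem_steepCircle hz
      simp only [hinv z hz]
      norm_num
      rw [← mul_assoc, inv_mul_cancel₀ h0, one_mul]
    rw [this, circleIntegral.integral_sub i2 i1, circleIntegral_inv_sub_one,
      circleIntegral_inv_add_one, sub_zero]
  | one =>
    have : phaseMoment (-((1 : ℕ) : ℤ) - 1) 1 =
        ∮ z in C(-3 / 4, 5 / 4), (((2 : ℂ) * z⁻¹ - (z + 1)⁻¹) - (z - 1)⁻¹) := by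
      refine circleIntegral.integral_congr (by norm_num) fun z hz => ?_
      have h0 := ne_zero_of_mem_steepCircle hz
      have h1 := hne1 z hz
      have h2 := hne2 z hz
      simp only [hinv z hz]
      rw [show (-((1 : ℕ) : ℤ) - 1) = -2 by norm_num, zpow_neg, show (2 : ℤ) = ((2 : ℕ) : ℤ) by rfl,
        zpow_natCast]
      field_simp
      ring
    have i02 : CircleIntegrable (fun z : ℂ => 2 * z⁻¹) (-3 / 4) (5 / 4) := by
      simpa [smul_eq_mul] using! i0.const_smul (a := (2 : ℂ))
    rw [this, circleIntegral.integral_sub (f := fun z => 2 * z⁻¹ - (z + 1)⁻¹) (i02.sub i2) i1, circleIntegral.integral_sub i02 i2,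
      circleIntegral_inv_sub_one, circleIntegral_inv_add_one, circleIntegral.integral_const_mul]
    have := circleIntegral.integral_sub_inv_of_mem_ball zero_mem_steepBall
    simp only [sub_zero] at this
    rw [this]
    ring
  | more n ih _ =>
    rw [← ih, ← sub_eq_zero, phaseMoment, phaseMoment, ← circleIntegral.integral_sub
      (circleIntegrable_phaseMoment _ _) (circleIntegrable_phaseMoment _ _)]
    have : (∮ z in C(-3 / 4, 5 / 4), (2 : ℂ) * z ^ (-(n : ℤ) - 2)) = 0 := by
      rw [circleIntegral.integral_const_mul, circleIntegral_zpow_eq_zero (by omega), mul_zero]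
    rw [← this]
    refine circleIntegral.integral_congr (by norm_num) fun z hz => ?_
    have h0 := ne_zero_of_mem_steepCircle hz
    have h1 := hne1 z hz
    have h2 := hne2 z hz
    simp only [hinv z hz]
    rw [show (-((n + 2 : ℕ) : ℤ) - 1) = -(n : ℤ) - 3 by push_cast; ring,
      show -(n : ℤ) - 1 = (-(n : ℤ) - 3) + 2 by ring,
      show -(n : ℤ) - 2 = (-(n : ℤ) - 3) + 1 by ring, zpow_add₀ h0 _ 2, zpow_add_one₀ h0,
      show (2 : ℤ) = ((2 : ℕ) : ℤ) by rfl, zpow_natCast]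
    field_simp
    ring

theorem circleIntegral_deriv_eq_zero {F F' : ℂ → ℂ} (h : ∀ z ∈ steepCircle, HasDerivAt F (F' z) z) :
    (∮ z in C(-3 / 4, 5 / 4), F' z) = 0 :=
  circleIntegral.integral_eq_zero_of_hasDerivWithinAt (by norm_num)
    fun z hz => (h z hz).hasDerivWithinAt

theorem phaseMoment_two (ν : ℕ) :
    phaseMoment (-(ν : ℤ) - 1) 2 = ν * (2 * Real.pi * Complex.I) := by
  have key : (∮ z in C(-3 / 4, 5 / 4), ((ν * (z ^ (-((ν + 1 : ℕ) : ℤ) - 1) * (besselPhase z ^ 1)⁻¹)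
      - ν * z ^ (-(ν : ℤ) - 1)) - z ^ (-(ν : ℤ) - 1) * (besselPhase z ^ 2)⁻¹)) = 0 := by
    -- The primitive is `z^(-ν) (z q') / q`, with `z q' = -(z + z⁻¹)/2`.
    refine circleIntegral_deriv_eq_zero
      (F := fun z => z ^ (-(ν : ℤ)) * (-(z + z⁻¹) / 2) * (besselPhase z)⁻¹) fun z hz => ?_
    have h0 := ne_zero_of_mem_steepCircle hz
    have hq := besselPhase_ne_zero hz
    have d1 := hasDerivAt_zpow (-(ν : ℤ)) z (Or.inl h0)
    have d2 := (((hasDerivAt_id z).add (hasDerivAt_inv h0)).neg).div_const 2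
    have d3 := (hasDerivAt_besselPhase h0).inv hq
    have := (d1.mul d2).mul d3
    convert! this using 1
    rw [show (-((ν + 1 : ℕ) : ℤ) - 1) = (-(ν : ℤ) - 1) - 1 by push_cast; ring,
      zpow_sub_one₀ h0 (-(ν : ℤ) - 1)]
    have hZ : z ^ (-(ν : ℤ)) = z ^ (-(ν : ℤ) - 1) * z := by
      rw [← zpow_add_one₀ h0]; ring_nf
    simp only [hZ, Pi.mul_apply, Pi.neg_apply, Pi.add_apply, Pi.inv_apply, id]
    generalize z ^ (-(ν : ℤ) - 1) = Z
    have hp : besselPhase z = (1 - z ^ 2) / (2 * z) := by rw [besselPhase]; field_simp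
    have h1 : 1 - z ^ 2 ≠ 0 := by
      intro h; rw [hp, h, zero_div] at hq; exact hq rfl
    rw [hp]
    push_cast
    field_simp
    ring
  have i1 : CircleIntegrable (fun z : ℂ => (ν : ℂ) * (z ^ (-((ν + 1 : ℕ) : ℤ) - 1) *
      (besselPhase z ^ 1)⁻¹)) (-3 / 4) (5 / 4) := by
    simpa [smul_eq_mul] using! (circleIntegrable_phaseMoment (-((ν + 1 : ℕ) : ℤ) - 1) 1).const_smul
      (a := (ν : ℂ))
  have i2 : CircleIntegrable (fun z : ℂ => (ν : ℂ) * z ^ (-(ν : ℤ) - 1)) (-3 / 4) (5 / 4) :=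
    ContinuousOn.circleIntegrable (by norm_num)
      (continuousOn_const.mul (continuousOn_zpow_steepCircle _))
  rw [circleIntegral.integral_sub (f := fun z => ν * (z ^ (-((ν + 1 : ℕ) : ℤ) - 1) *
      (besselPhase z ^ 1)⁻¹) - ν * z ^ (-(ν : ℤ) - 1)) (i1.sub i2)
      (circleIntegrable_phaseMoment _ 2),
    circleIntegral.integral_sub i1 i2, circleIntegral.integral_const_mul,
    circleIntegral.integral_const_mul] at key
  change ν * phaseMoment (-((ν + 1 : ℕ) : ℤ) - 1) 1 - _ - phaseMoment (-(ν : ℤ) - 1) 2 = 0 at key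
  rw [phaseMoment_base] at key
  rcases Nat.eq_zero_or_pos ν with rfl | hν
  · simpa using key
  · rw [circleIntegral_zpow_eq_zero (by omega)] at key
    linear_combination -key

/-- With `D = z d/dz`, the phase satisfies `D²q = q` and `(Dq)² = 1 + q²`, so `D²(q^(-k)) = k²
q^(-k) + k(k+1) q^(-k-2)`. Two integrations by parts against `z^(-ν)` replace `D²` by `ν²`; the
primitive below packages both. -/
theorem phaseMoment_recurrence (ν k : ℕ) :
    ((ν : ℂ) ^ 2 - k ^ 2) * phaseMoment (-(ν : ℤ) - 1) k =
      k * (k + 1) * phaseMoment (-(ν : ℤ) - 1) (k + 2) := by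
  have key : (∮ z in C(-3 / 4, 5 / 4),
      (((ν : ℂ) ^ 2 - k ^ 2) * (z ^ (-(ν : ℤ) - 1) * (besselPhase z ^ k)⁻¹) -
        k * (k + 1) * (z ^ (-(ν : ℤ) - 1) * (besselPhase z ^ (k + 2))⁻¹))) = 0 := by
    refine circleIntegral_deriv_eq_zero (F := fun z => z ^ (-(ν : ℤ)) *
      (k * (-(z + z⁻¹) / 2) * (besselPhase z ^ (k + 1))⁻¹ - ν * (besselPhase z ^ k)⁻¹))
      fun z hz => ?_
    have h0 := ne_zero_of_mem_steepCircle hz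
    have hq := besselPhase_ne_zero hz
    have d1 := hasDerivAt_zpow (-(ν : ℤ)) z (Or.inl h0)
    have d2 := ((((hasDerivAt_id z).add (hasDerivAt_inv h0)).neg).div_const 2).const_mul (k : ℂ)
    have d3 := ((hasDerivAt_besselPhase h0).pow (k + 1)).inv (pow_ne_zero _ hq)
    have d4 := (((hasDerivAt_besselPhase h0).pow k).inv (pow_ne_zero _ hq)).const_mul (ν : ℂ)
    have := d1.mul ((d2.mul d3).sub d4)
    convert! this using 1
    have hZ : z ^ (-(ν : ℤ)) = z ^ (-(ν : ℤ) - 1) * z := by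
      rw [← zpow_add_one₀ h0]; ring_nf
    simp only [hZ, add_tsub_cancel_right, Pi.mul_apply, Pi.neg_apply, Pi.add_apply, Pi.sub_apply,
      Pi.pow_apply, Pi.inv_apply, id]
    generalize z ^ (-(ν : ℤ) - 1) = Z
    have hp : besselPhase z = (1 - z ^ 2) / (2 * z) := by rw [besselPhase]; field_simp
    have h1 : 1 - z ^ 2 ≠ 0 := by
      intro h; rw [hp, h, zero_div] at hq; exact hq rfl
    have hk : (k : ℂ) * besselPhase z ^ (k - 1) = k * besselPhase z ^ k / besselPhase z := by
      rcases Nat.eq_zero_or_pos k with rfl | hk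
      · simp
      · obtain ⟨m, rfl⟩ := Nat.exists_eq_add_of_le' hk
        rw [Nat.add_sub_cancel, pow_succ]
        field_simp
    rw [hk]
    have hQ : besselPhase z ^ k ≠ 0 := pow_ne_zero _ hq
    simp only [pow_add, pow_one]
    generalize besselPhase z ^ k = Q at hQ
    rw [hp]
    push_cast
    field_simp
    ring
  have i1 := fun (a : ℂ) k => (circleIntegrable_phaseMoment (-(ν : ℤ) - 1) k).const_smul (a := a)
  have e := circleIntegral.integral_sub (i1 ((ν : ℂ) ^ 2 - k ^ 2) k) (i1 (k * (k + 1)) (k + 2))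
  simp only [Pi.smul_apply, smul_eq_mul, circleIntegral.integral_const_mul] at e
  rw [e] at key
  exact sub_eq_zero.1 key

/-- The Abel moments of the Bessel function: `∫₀^∞ x^k J_ν(x) dx`. -/
theorem phaseMoment_eq_Gamma (ν k : ℕ) :
    (k.factorial : ℂ) * ((2 * Real.pi * Complex.I)⁻¹ * phaseMoment (-(ν : ℤ) - 1) (k + 1)) =
      ((2 ^ k * (Real.Gamma (((ν : ℝ) + k + 1) / 2) / Real.Gamma (((ν : ℝ) - k + 1) / 2)) : ℝ) : ℂ) := by
  have hpi : (2 * Real.pi * Complex.I : ℂ) ≠ 0 := Complex.two_pi_I_ne_zero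
  induction k using Nat.twoStepInduction with
  | zero =>
    rw [zero_add, phaseMoment_base, inv_mul_cancel₀ hpi]
    have : Real.Gamma (((ν : ℝ) + 1) / 2) ≠ 0 := (Real.Gamma_pos_of_pos (by positivity)).ne'
    simp [this]
  | one =>
    rw [phaseMoment_two]
    have h1 : (2 * Real.pi * Complex.I : ℂ)⁻¹ * (ν * (2 * Real.pi * Complex.I)) = ν := by
      field_simp
    rw [h1]
    rcases Nat.eq_zero_or_pos ν with rfl | hν
    · simp
    · have h2 : (0 : ℝ) < (ν : ℝ) / 2 := by positivity
      have : ((ν : ℝ) + (1 : ℕ) + 1) / 2 = (ν : ℝ) / 2 + 1 := by push_cast; ring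
      rw [this, Real.Gamma_add_one h2.ne']
      have : ((ν : ℝ) - (1 : ℕ) + 1) / 2 = (ν : ℝ) / 2 := by push_cast; ring
      rw [this]
      have := (Real.Gamma_pos_of_pos h2).ne'
      rw [mul_div_assoc, div_self this]
      push_cast
      simp
      ring
  | more k ih _ =>
    have hrec := phaseMoment_recurrence ν (k + 1)
    have e1 : ((k + 2).factorial : ℂ) = (k + 1 + 1) * ((k + 1) * k.factorial) := by
      rw [Nat.factorial_succ, Nat.factorial_succ]; push_cast; ring
    have e2 : ((k + 2).factorial : ℂ) * ((2 * Real.pi * Complex.I)⁻¹ *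
        phaseMoment (-(ν : ℤ) - 1) (k + 2 + 1)) = ((ν : ℂ) ^ 2 - (k + 1) ^ 2) *
        ((k.factorial : ℂ) * ((2 * Real.pi * Complex.I)⁻¹ * phaseMoment (-(ν : ℤ) - 1) (k + 1))) := by
      rw [e1]
      push_cast at hrec
      rw [show k + 2 + 1 = k + 1 + 2 by ring]
      linear_combination (-(k.factorial : ℂ) * (2 * Real.pi * Complex.I)⁻¹) * hrec
    have h4 : (ν : ℂ) ^ 2 - (k + 1) ^ 2 = (((ν : ℝ) ^ 2 - (k + 1) ^ 2 : ℝ) : ℂ) := by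
      push_cast; ring
    rw [e2, ih, h4, ← Complex.ofReal_mul]
    congr 1
    have h1 : (0 : ℝ) < ((ν : ℝ) + k + 1) / 2 := by positivity
    have a1 : ((ν : ℝ) + (k + 2 : ℕ) + 1) / 2 = ((ν : ℝ) + k + 1) / 2 + 1 := by push_cast; ring
    have a2 : ((ν : ℝ) - k + 1) / 2 = ((ν : ℝ) - (k + 2 : ℕ) + 1) / 2 + 1 := by push_cast; ring
    rw [a1, Real.Gamma_add_one h1.ne', a2]
    set y : ℝ := ((ν : ℝ) - (k + 2 : ℕ) + 1) / 2 with hy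
    have h5 : (ν : ℝ) ^ 2 - (k + 1) ^ 2 = 4 * (((ν : ℝ) + k + 1) / 2) * y := by
      rw [hy]; push_cast; ring
    rw [h5]
    -- Poles of Gamma: at `y = 0` the factor `ν² - (k+1)²` vanishes, and at the other poles `Γ(y)`
    -- and `Γ(y+1)` both have default value `0`, so both sides are `0`.
    by_cases hy0 : y = 0
    · rw [hy0]; simp
    · rw [Real.Gamma_add_one hy0]
      by_cases hG : Real.Gamma y = 0
      · rw [hG]; simp
      · field_simp
        ring

/-! ### Laplace integrals and rotation of the ray -/

theorem one_add_pow_mul_exp_le (m : ℕ) {c : ℝ} (hc : 0 < c) {r : ℝ} (hr : 0 ≤ r) :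
    (1 + r) ^ m * Real.exp (-(c * r)) ≤ m.factorial * Real.exp c / c ^ m := by
  have h := Real.pow_div_factorial_le_exp _ (show 0 ≤ c * (1 + r) by positivity) m
  rw [div_le_iff₀ (by positivity), mul_pow] at h
  rw [le_div_iff₀ (by positivity)]
  calc (1 + r) ^ m * Real.exp (-(c * r)) * c ^ m
      = c ^ m * (1 + r) ^ m * Real.exp (-(c * r)) := by ring
    _ ≤ Real.exp (c * (1 + r)) * m.factorial * Real.exp (-(c * r)) := by gcongr
    _ = m.factorial * (Real.exp (c * (1 + r)) * Real.exp (-(c * r))) := by ring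
    _ = _ := by rw [← Real.exp_add]; ring_nf

theorem integrableOn_pow_mul_exp (k : ℕ) {c : ℝ} (hc : 0 < c) :
    IntegrableOn (fun x : ℝ => x ^ k * Real.exp (-(c * x))) (Ioi 0) := by
  have := integrableOn_rpow_mul_exp_neg_mul_rpow (p := 1) (s := k) (b := c)
    (by linarith [Nat.cast_nonneg (α := ℝ) k]) one_pos hc
  refine this.congr_fun (fun x _ => ?_) measurableSet_Ioi
  simp only [Real.rpow_natCast, Real.rpow_one, neg_mul]

theorem integral_pow_mul_exp (k : ℕ) {c : ℝ} (hc : 0 < c) :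
    ∫ x in Ioi (0 : ℝ), x ^ k * Real.exp (-(c * x)) = k.factorial / c ^ (k + 1) := by
  have h := Real.integral_rpow_mul_exp_neg_mul_Ioi (a := k + 1) (r := c) (by positivity) hc
  rw [Real.Gamma_nat_eq_factorial] at h
  simp only [add_sub_cancel_right, Real.rpow_natCast] at h
  rw [h, ← Nat.cast_add_one, Real.rpow_natCast, one_div, inv_pow]
  field_simp

theorem norm_cexp_neg_mul_ofReal (p : ℂ) (x : ℝ) :
    ‖Complex.exp (-(p * x))‖ = Real.exp (-(p.re * x)) := by
  rw [Complex.norm_exp, Complex.neg_re, Complex.re_mul_ofReal]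

theorem integrableOn_pow_mul_cexp (k : ℕ) {p : ℂ} (hp : 0 < p.re) :
    IntegrableOn (fun x : ℝ => (x : ℂ) ^ k * Complex.exp (-(p * x))) (Ioi 0) := by
  refine (integrableOn_pow_mul_exp k hp).mono' (Continuous.aestronglyMeasurable (by fun_prop))
    ((ae_restrict_iff' measurableSet_Ioi).2 (Eventually.of_forall fun x hx => ?_))
  rw [norm_mul, norm_pow, Complex.norm_real, Real.norm_of_nonneg (le_of_lt hx),
    norm_cexp_neg_mul_ofReal]

theorem integral_pow_mul_cexp (k : ℕ) {p : ℂ} (hp : 0 < p.re) :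
    ∫ x in Ioi (0 : ℝ), (x : ℂ) ^ k * Complex.exp (-(p * x)) = k.factorial / p ^ (k + 1) := by
  have hp0 : p ≠ 0 := by rintro rfl; simp at hp
  have hderiv : ∀ (k : ℕ) (x : ℝ), HasDerivAt (fun x : ℝ => (x : ℂ) ^ k * Complex.exp (-(p * x)))
      (k * (x : ℂ) ^ (k - 1) * Complex.exp (-(p * x)) -
        p * ((x : ℂ) ^ k * Complex.exp (-(p * x)))) x := by
    intro k x
    have h1 : HasDerivAt (fun z : ℂ => z ^ k * Complex.exp (-(p * z)))
        (k * (x : ℂ) ^ (k - 1) * Complex.exp (-(p * x)) +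
          (x : ℂ) ^ k * (Complex.exp (-(p * x)) * -(p * 1))) (x : ℂ) :=
      (hasDerivAt_pow k (x : ℂ)).mul (((hasDerivAt_id (x : ℂ)).const_mul p).neg.cexp)
    convert! h1.comp_ofReal using 1
    ring
  have hlim : ∀ k : ℕ, Tendsto (fun x : ℝ => (x : ℂ) ^ k * Complex.exp (-(p * x))) atTop (𝓝 0) := by
    intro k
    rw [tendsto_zero_iff_norm_tendsto_zero]
    have := Real.tendsto_pow_mul_exp_neg_atTop_nhds_zero k
    have h2 := (this.comp (tendsto_id.const_mul_atTop hp)).const_mul ((p.re ^ k)⁻¹)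
    rw [mul_zero] at h2
    refine h2.congr' ((eventually_ge_atTop 0).mono fun x hx => ?_)
    simp only [norm_mul, norm_pow, Complex.norm_real, Real.norm_of_nonneg hx,
      norm_cexp_neg_mul_ofReal, Function.comp_apply, id, mul_pow]
    field_simp
  induction k with
  | zero =>
    have h := integral_Ioi_of_hasDerivAt_of_tendsto' (a := 0) (fun x _ => hderiv 0 x) ?_ (hlim 0)
    · simp only [Nat.cast_zero, zero_mul, zero_sub, pow_zero, one_mul, Complex.ofReal_zero, mul_zero,
        neg_zero, Complex.exp_zero] at h
      rw [integral_neg, integral_const_mul] at h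
      simp only [pow_zero, one_mul, Nat.factorial_zero, Nat.cast_one, zero_add, pow_one]
      rw [eq_div_iff hp0]
      linear_combination -h
    · simpa using! ((integrableOn_pow_mul_cexp 0 hp).const_mul p).neg
  | succ k ih =>
    have i1 := (integrableOn_pow_mul_cexp k hp).const_mul ((k + 1 : ℕ) : ℂ)
    have i2 := (integrableOn_pow_mul_cexp (k + 1) hp).const_mul p
    have h := integral_Ioi_of_hasDerivAt_of_tendsto' (a := 0) (fun x _ => hderiv (k + 1) x) ?_
      (hlim (k + 1))
    · simp only [Nat.add_sub_cancel, mul_assoc] at h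
      rw [integral_sub i1 i2, integral_const_mul, integral_const_mul, ih] at h
      have hf : (((k + 1).factorial : ℕ) : ℂ) = ((k + 1 : ℕ) : ℂ) * (k.factorial : ℂ) := by
        rw [Nat.factorial_succ]; push_cast; ring
      rw [hf]
      simp only [Complex.ofReal_zero, ne_eq, Nat.add_eq_zero_iff, one_ne_zero, and_false,
        not_false_eq_true, zero_pow, zero_mul, sub_zero] at h
      rw [pow_succ p (k + 1), ← div_div, eq_div_iff hp0, mul_div_assoc]
      linear_combination -h
    · simpa [mul_assoc] using! i1.sub i2

theorem integrableOn_Ioi_iff_comp_exp (g : ℝ → ℂ) :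
    IntegrableOn g (Ioi 0) ↔ Integrable fun x : ℝ => (Real.exp x : ℂ) * g (Real.exp x) := by
  have h := integrableOn_image_iff_integrableOn_abs_deriv_smul (s := univ) MeasurableSet.univ
    (fun x _ => (Real.hasDerivAt_exp x).hasDerivWithinAt) Real.exp_injective.injOn g
  rw [image_univ, Real.range_exp, integrableOn_univ] at h
  simpa [abs_of_pos (Real.exp_pos _)] using h

theorem integral_Ioi_eq_comp_exp (g : ℝ → ℂ) :
    ∫ x in Ioi 0, g x = ∫ x : ℝ, (Real.exp x : ℂ) * g (Real.exp x) := by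
  have h := integral_image_eq_integral_abs_deriv_smul (s := univ) MeasurableSet.univ
    (fun x _ => (Real.hasDerivAt_exp x).hasDerivWithinAt) Real.exp_injective.injOn g
  rw [image_univ, Real.range_exp, setIntegral_univ] at h
  simpa [abs_of_pos (Real.exp_pos _)] using h

/-- Rotation of the half line of integration. -/
theorem integral_Ioi_eq_rotate {g : ℂ → ℂ} {C α : ℝ} (hα : |α| < Real.pi / 2)
    (hg : DifferentiableOn ℂ g {z | 0 < z.re})
    (hb : ∀ r : ℝ, 0 < r → ∀ θ ∈ uIcc 0 α, ‖g (r * Complex.exp (θ * Complex.I))‖ ≤ C / (1 + r ^ 2)) :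
    ∫ r in Ioi (0 : ℝ), g r =
      Complex.exp (α * Complex.I) * ∫ r in Ioi (0 : ℝ), g (r * Complex.exp (α * Complex.I)) := by
  have hθ : ∀ θ ∈ uIcc 0 α, 0 < Real.cos θ := by
    intro θ hθ
    have h1 : |θ| ≤ |α| := by simpa using abs_sub_left_of_mem_uIcc hθ
    have := abs_lt.1 (lt_of_le_of_lt h1 hα)
    exact Real.cos_pos_of_mem_Ioo ⟨by linarith, by linarith⟩
  have hre : ∀ u : ℂ, u.im ∈ uIcc 0 α → 0 < (Complex.exp u).re := by
    intro u hu
    rw [Complex.exp_re]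
    exact mul_pos (Real.exp_pos _) (hθ _ hu)
  -- The substitution `r = e^x` turns the sector into a horizontal strip and rotation into a shift
  -- of the line, so Cauchy's theorem on rectangles applies.
  set G : ℂ → ℂ := fun u => Complex.exp u * g (Complex.exp u) with hG
  have hGd : ∀ u : ℂ, u.im ∈ uIcc 0 α → DifferentiableAt ℂ G u := by
    intro u hu
    have h1 : DifferentiableAt ℂ g (Complex.exp u) := hg.differentiableAt
      ((isOpen_lt continuous_const Complex.continuous_re).mem_nhds (hre u hu))
    exact Complex.differentiableAt_exp.mul (h1.comp u Complex.differentiableAt_exp)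
  have hexp : ∀ x y : ℝ, Complex.exp (x + y * Complex.I) =
      (Real.exp x : ℂ) * Complex.exp (y * Complex.I) := by
    intro x y; rw [Complex.exp_add, Complex.ofReal_exp]
  have hC : 0 ≤ C := by
    have := (norm_nonneg _).trans (hb 1 one_pos 0 left_mem_uIcc)
    norm_num at this
    linarith
  -- The Jacobian `e^x` against `1 / (1 + e^{2x})` leaves decay `e^{-|x|}`, which kills both
  -- vertical sides.
  have hGb : ∀ x y : ℝ, y ∈ uIcc 0 α → ‖G (x + y * Complex.I)‖ ≤ C * Real.exp (-|x|) := by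
    intro x y hy
    have h1 := hb (Real.exp x) (Real.exp_pos x) y hy
    simp only [hG, hexp]
    rw [norm_mul, norm_mul, Complex.norm_exp_ofReal_mul_I, mul_one, Complex.norm_real,
      Real.norm_of_nonneg (Real.exp_pos x).le]
    have hp := Real.exp_pos x
    calc Real.exp x * ‖g (Real.exp x * Complex.exp (y * Complex.I))‖
        ≤ Real.exp x * (C / (1 + Real.exp x ^ 2)) := by gcongr
      _ = C * (Real.exp x / (1 + Real.exp x ^ 2)) := by ring
      _ ≤ C * Real.exp (-|x|) := by
        refine mul_le_mul_of_nonneg_left ?_ hC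
        rw [div_le_iff₀ (by positivity)]
        rcases abs_cases x with ⟨h, hx⟩ | ⟨h, hx⟩
        · rw [h, mul_add, mul_one, sq, ← mul_assoc, ← Real.exp_add, neg_add_cancel, Real.exp_zero,
            one_mul]
          linarith [Real.exp_pos (-x)]
        · rw [h, neg_neg]
          nlinarith [Real.exp_pos x, sq_nonneg (Real.exp x)]
  have hint : ∀ y ∈ uIcc 0 α, Integrable fun x : ℝ => G (x + y * Complex.I) := by
    intro y hy
    have h1 : IntegrableOn (fun r : ℝ => Complex.exp (y * Complex.I) *
        g (r * Complex.exp (y * Complex.I))) (Ioi 0) := by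
      have hbd : IntegrableOn (fun r : ℝ => C * (1 + r ^ 2)⁻¹) (Ioi 0) :=
        (integrable_inv_one_add_sq.const_mul C).integrableOn
      refine hbd.mono' ?_ ((ae_restrict_iff' measurableSet_Ioi).2 (Eventually.of_forall
        fun r hr => ?_))
      · refine ContinuousOn.aestronglyMeasurable (continuousOn_const.mul
          (hg.continuousOn.comp (by fun_prop) fun r hr => ?_)) measurableSet_Ioi
        rw [mem_ofPred_eq, Complex.re_ofReal_mul, Complex.exp_ofReal_mul_I_re]
        exact mul_pos hr (hθ y hy)
      · rw [norm_mul, Complex.norm_exp_ofReal_mul_I, one_mul, ← div_eq_mul_inv]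
        exact hb r hr y hy
    rw [integrableOn_Ioi_iff_comp_exp] at h1
    refine h1.congr (Eventually.of_forall fun x => ?_)
    simp only [hG, hexp]
    ring
  have hval : ∀ y : ℝ, ∫ x : ℝ, G (x + y * Complex.I) =
      Complex.exp (y * Complex.I) * ∫ r in Ioi (0 : ℝ), g (r * Complex.exp (y * Complex.I)) := by
    intro y
    rw [integral_Ioi_eq_comp_exp, ← integral_const_mul]
    congr 1
    ext x
    simp only [hG, hexp]
    ring
  have hT : ∀ T : ℝ, 0 < T → ‖(∫ x in (-T)..T, G (x + (0 : ℝ) * Complex.I)) -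
      ∫ x in (-T)..T, G (x + α * Complex.I)‖ ≤ 2 * (C * |α| * Real.exp (-T)) := by
    intro T hT
    have h := Complex.integral_boundary_rect_eq_zero_of_differentiableOn G (-T : ℝ)
      ((T : ℂ) + α * Complex.I) (fun u hu => (hGd u (by simpa using hu.2)).differentiableWithinAt)
    simp only [Complex.ofReal_re, Complex.ofReal_im, Complex.add_re, Complex.mul_re, Complex.I_re,
      mul_zero, Complex.I_im, mul_one, sub_self, add_zero, Complex.add_im, Complex.mul_im,
      zero_add] at h
    have hside : ∀ x : ℝ, |x| = T → ‖Complex.I • ∫ y in (0 : ℝ)..α, G (x + y * Complex.I)‖ ≤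
        C * |α| * Real.exp (-T) := by
      intro x hx
      rw [norm_smul, Complex.norm_I, one_mul]
      have := intervalIntegral.norm_integral_le_of_norm_le_const (a := 0) (b := α)
        (f := fun y : ℝ => G (x + y * Complex.I)) (C := C * Real.exp (-T)) (fun y hy => by
          have := hGb x y (uIoc_subset_uIcc hy); rwa [hx] at this)
      rw [sub_zero] at this
      linarith
    have h1 := hside T (abs_of_pos hT)
    have h2 := hside (-T) (by rw [abs_neg, abs_of_pos hT])
    have e : (∫ x in (-T)..T, G (x + (0 : ℝ) * Complex.I)) -
      (∫ x in (-T)..T, G (x + α * Complex.I)) =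
      Complex.I • (∫ y in (0 : ℝ)..α, G ((-T : ℝ) + y * Complex.I)) -
      Complex.I • ∫ y in (0 : ℝ)..α, G (T + y * Complex.I) := by
      linear_combination h
    rw [e]
    exact (norm_sub_le _ _).trans (by linarith)
  have l1 := intervalIntegral_tendsto_integral (hint 0 left_mem_uIcc) tendsto_neg_atTop_atBot
    tendsto_id
  have l2 := intervalIntegral_tendsto_integral (hint α right_mem_uIcc) tendsto_neg_atTop_atBot
    tendsto_id
  have l3 : Tendsto (fun T : ℝ => 2 * (C * |α| * Real.exp (-T))) atTop (𝓝 0) := by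
    have := (Real.tendsto_exp_neg_atTop_nhds_zero.const_mul (C * |α|)).const_mul 2
    simpa using this
  have l4 := squeeze_zero_norm' ((eventually_gt_atTop 0).mono hT) l3
  have := sub_eq_zero.1 (tendsto_nhds_unique (l1.sub l2) l4)
  rw [hval, hval] at this
  simpa using this

/-! ### Taylor remainders and Watson's lemma -/

/-- The Taylor polynomial of `f` at `0`, with `N` terms. -/
noncomputable def taylorSum (f : ℂ → ℂ) (N : ℕ) (z : ℂ) : ℂ :=
  ∑ k ∈ Finset.range N, iteratedDeriv k f 0 / k.factorial * z ^ k

theorem differentiable_taylorSum (f : ℂ → ℂ) (N : ℕ) : Differentiable ℂ (taylorSum f N) := by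
  unfold taylorSum
  fun_prop

theorem taylorSum_remainder {f : ℂ → ℂ} (hf0 : AnalyticAt ℂ f 0) (N : ℕ) :
    (fun z => f z - taylorSum f N z) =O[𝓝 0] fun z => ‖z‖ ^ N := by
  have h := hf0.hasFPowerSeriesAt.isBigO_sub_partialSum_pow N
  refine h.congr_left fun z => ?_
  simp [taylorSum, FormalMultilinearSeries.partialSum,
    mul_comm]

theorem norm_taylorSum_le (f : ℂ → ℂ) (N : ℕ) :
    ∃ C : ℝ, 0 ≤ C ∧ ∀ z, ‖taylorSum f N z‖ ≤ C * (1 + ‖z‖) ^ N := by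
  refine ⟨∑ k ∈ Finset.range N, ‖iteratedDeriv k f 0 / k.factorial‖,
    Finset.sum_nonneg fun _ _ => norm_nonneg _, fun z => ?_⟩
  rw [taylorSum, Finset.sum_mul]
  refine (norm_sum_le _ _).trans (Finset.sum_le_sum fun k hk => ?_)
  rw [norm_mul, norm_pow]
  gcongr
  calc ‖z‖ ^ k ≤ (1 + ‖z‖) ^ k := by gcongr; linarith
    _ ≤ (1 + ‖z‖) ^ N := pow_le_pow_right₀ (by linarith [norm_nonneg z])
        (Finset.mem_range.1 hk).le

/-- `f` is holomorphic on the right half plane and at `0`, and grows at most polynomially. -/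
structure HankelAdmissible (f : ℂ → ℂ) : Prop where
  analytic : AnalyticOnNhd ℂ f {z : ℂ | 0 < z.re}
  analytic_zero : AnalyticAt ℂ f 0
  growth : ∃ σ K R : ℝ, ∀ z : ℂ, 0 < z.re → R ≤ ‖z‖ → ‖f z‖ ≤ K * ‖z‖ ^ σ

/-- The growth hypothesis controls only large `|z|`. Truncating the closed sector `|Im z| ≤ Re z`
away from `0` leaves a compact subset of the open half plane, where continuity suffices; near the
imaginary axis nothing bounds `f`. -/
theorem HankelAdmissible.bound_away {f : ℂ → ℂ} (hf : HankelAdmissible f) {r : ℝ} (hr : 0 < r) :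
    ∃ (C : ℝ) (M : ℕ), 0 ≤ C ∧ ∀ z : ℂ, 0 < z.re → |z.im| ≤ z.re → r ≤ ‖z‖ →
      ‖f z‖ ≤ C * (1 + ‖z‖) ^ M := by
  obtain ⟨σ, K, R, hK⟩ := hf.growth
  obtain ⟨M, hM⟩ := exists_nat_ge σ
  set S : Set ℂ := Metric.closedBall 0 (max R 1) ∩ {z | r ≤ ‖z‖} ∩ {z | |z.im| ≤ z.re} with hS
  have hSc : IsCompact S := ((isCompact_closedBall _ _).inter_right
    (isClosed_le continuous_const continuous_norm)).inter_right
    (isClosed_le (continuous_abs.comp Complex.continuous_im) Complex.continuous_re)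
  have hSs : S ⊆ {z : ℂ | 0 < z.re} := by
    rintro z ⟨⟨-, h2⟩, h3⟩
    rcases (abs_nonneg z.im |>.trans h3).eq_or_lt with h | h
    · exfalso
      have h4 : z.im = 0 := by
        have : |z.im| ≤ z.re := h3
        rw [← h] at this
        exact abs_nonpos_iff.1 this
      have : z = 0 := Complex.ext h.symm h4
      have h2 : r ≤ ‖z‖ := h2
      rw [this, norm_zero] at h2
      linarith
    · exact h
  obtain ⟨B, hB⟩ := hSc.exists_bound_of_continuousOn (hf.analytic.continuousOn.mono hSs)
  refine ⟨max B 0 + |K|, M, by positivity, fun z hz hz2 hz3 => ?_⟩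
  have h1 : 1 ≤ (1 + ‖z‖) ^ M := one_le_pow₀ (by linarith [norm_nonneg z])
  have hK0 := abs_nonneg K
  have hB0 := le_max_right B 0
  rcases le_total ‖z‖ (max R 1) with h | h
  · have := hB z ⟨⟨by simpa using h, hz3⟩, hz2⟩
    calc ‖f z‖ ≤ max B 0 := this.trans (le_max_left _ _)
      _ ≤ (max B 0 + |K|) * 1 := by linarith
      _ ≤ _ := by gcongr
  · have hz1 : 1 ≤ ‖z‖ := (le_max_right _ _).trans h
    calc ‖f z‖ ≤ K * ‖z‖ ^ σ := hK z hz ((le_max_left _ _).trans h)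
      _ ≤ |K| * ‖z‖ ^ (M : ℝ) := by
        gcongr
        · exact le_abs_self K
      _ = |K| * ‖z‖ ^ M := by rw [Real.rpow_natCast]
      _ ≤ (max B 0 + |K|) * (1 + ‖z‖) ^ M := by
        gcongr
        · linarith
        · linarith

/-- Near `0` this is Taylor's theorem. Away from `0` both terms grow polynomially and the missing
factor `‖z‖^N` is supplied by `‖z‖^N / r^N ≥ 1`. -/
theorem HankelAdmissible.remainder_bound {f : ℂ → ℂ} (hf : HankelAdmissible f) (N : ℕ) :
    ∃ (C : ℝ) (M : ℕ), 0 ≤ C ∧ ∀ z : ℂ, 0 < z.re → |z.im| ≤ z.re →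
      ‖f z - taylorSum f N z‖ ≤ C * (‖z‖ ^ N * (1 + ‖z‖) ^ M) := by
  obtain ⟨A, hA⟩ := (taylorSum_remainder hf.analytic_zero N).bound
  obtain ⟨r, hr, hball⟩ := Metric.eventually_nhds_iff.1 hA
  obtain ⟨C, M, hC, hM⟩ := hf.bound_away hr
  obtain ⟨D, hD, hT⟩ := norm_taylorSum_le f N
  refine ⟨|A| + (C + D) / r ^ N, M + N, by positivity, fun z hz hz2 => ?_⟩
  have h1 : ∀ m, 1 ≤ (1 + ‖z‖) ^ m := fun m => one_le_pow₀ (by linarith [norm_nonneg z])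
  rcases lt_or_ge ‖z‖ r with h | h
  · have := hball (show dist z 0 < r by simpa using h)
    rw [Real.norm_of_nonneg (by positivity)] at this
    calc _ ≤ A * ‖z‖ ^ N := this
      _ ≤ |A| * ‖z‖ ^ N := by gcongr; exact le_abs_self A
      _ ≤ (|A| + (C + D) / r ^ N) * (‖z‖ ^ N * 1) := by
        rw [mul_one]; gcongr; linarith [show 0 ≤ (C + D) / r ^ N by positivity]
      _ ≤ _ := by gcongr; exact h1 _
  · have e : 1 ≤ ‖z‖ ^ N / r ^ N := by
      rw [le_div_iff₀ (by positivity), one_mul]; gcongr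
    calc _ ≤ ‖f z‖ + ‖taylorSum f N z‖ := norm_sub_le _ _
      _ ≤ C * (1 + ‖z‖) ^ M + D * (1 + ‖z‖) ^ N := add_le_add (hM z hz hz2 h) (hT z)
      _ ≤ C * (1 + ‖z‖) ^ (M + N) + D * (1 + ‖z‖) ^ (M + N) := by
        gcongr
        · linarith [norm_nonneg z]
        · omega
        · linarith [norm_nonneg z]
        · omega
      _ = (C + D) * 1 * (1 + ‖z‖) ^ (M + N) := by ring
      _ ≤ (C + D) * (‖z‖ ^ N / r ^ N) * (1 + ‖z‖) ^ (M + N) := by gcongr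
      _ = (C + D) / r ^ N * (‖z‖ ^ N * (1 + ‖z‖) ^ (M + N)) := by ring
      _ ≤ _ := by gcongr; linarith [abs_nonneg A]

theorem continuousOn_ofReal_comp {g : ℂ → ℂ} (hg : DifferentiableOn ℂ g {z | 0 < z.re}) :
    ContinuousOn (fun x : ℝ => g x) (Ioi 0) :=
  hg.continuousOn.comp Complex.continuous_ofReal.continuousOn fun x hx => by simpa using hx

theorem integrableOn_mul_cexp_of_bound {h : ℂ → ℂ} {C : ℝ} {N M : ℕ}
    (hd : DifferentiableOn ℂ h {z | 0 < z.re})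
    (hb : ∀ z : ℂ, 0 < z.re → |z.im| ≤ z.re → ‖h z‖ ≤ C * (‖z‖ ^ N * (1 + ‖z‖) ^ M))
    (hC : 0 ≤ C) {p : ℂ} (hp : 0 < p.re) :
    IntegrableOn (fun x : ℝ => h x * Complex.exp (-(p * x))) (Ioi 0) := by
  have hi := (integrableOn_pow_mul_exp N (half_pos hp)).const_mul
    (C * (M.factorial * Real.exp (p.re / 2) / (p.re / 2) ^ M))
  refine hi.mono' ((continuousOn_ofReal_comp hd).mul (by fun_prop) |>.aestronglyMeasurable
    measurableSet_Ioi) ((ae_restrict_iff' measurableSet_Ioi).2 (Eventually.of_forall fun x hx => ?_))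
  have hx : 0 < x := hx
  have h1 := hb x (by simpa using hx) (by simpa using hx.le)
  have h2 := one_add_pow_mul_exp_le M (half_pos hp) hx.le
  rw [norm_mul, norm_cexp_neg_mul_ofReal]
  rw [Complex.norm_real, Real.norm_of_nonneg hx.le] at h1
  have e : Real.exp (-(p.re * x)) = Real.exp (-(p.re / 2 * x)) * Real.exp (-(p.re / 2 * x)) := by
    rw [← Real.exp_add]; ring_nf
  calc ‖h x‖ * Real.exp (-(p.re * x))
      ≤ C * (x ^ N * (1 + x) ^ M) * Real.exp (-(p.re * x)) := by gcongr
    _ = C * ((1 + x) ^ M * Real.exp (-(p.re / 2 * x))) * (x ^ N * Real.exp (-(p.re / 2 * x))) := by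
        rw [e]; ring
    _ ≤ C * (M.factorial * Real.exp (p.re / 2) / (p.re / 2) ^ M) *
        (x ^ N * Real.exp (-(p.re / 2 * x))) := by gcongr

/-- The constant must survive `Re p → 0`. Rotating the ray by `π/4` against the sign of `Im p` keeps
it in the sector where `h` is controlled and makes the exponential decay at rate at least `‖p‖/2`.
-/
theorem laplace_bound {h : ℂ → ℂ} {C : ℝ} {N M : ℕ}
    (hd : DifferentiableOn ℂ h {z | 0 < z.re})
    (hb : ∀ z : ℂ, 0 < z.re → |z.im| ≤ z.re → ‖h z‖ ≤ C * (‖z‖ ^ N * (1 + ‖z‖) ^ M))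
    (hC : 0 ≤ C) {δ : ℝ} (hδ : 0 < δ) :
    ∃ D : ℝ, 0 ≤ D ∧ ∀ p : ℂ, 0 < p.re → δ ≤ ‖p‖ →
      ‖∫ x in Ioi (0 : ℝ), h x * Complex.exp (-(p * x))‖ ≤ D / ‖p‖ ^ (N + 1) := by
  set B : ℝ := M.factorial * Real.exp (δ / 4) / (δ / 4) ^ M with hB
  have hB0 : 0 ≤ B := by positivity
  refine ⟨C * B * N.factorial * 4 ^ (N + 1), by positivity, fun p hp hδp => ?_⟩
  have hpi := Real.pi_pos
  obtain ⟨α, hα, hθc, hsgn, hlow⟩ : ∃ α : ℝ, |α| ≤ Real.pi / 4 ∧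
      (∀ θ ∈ uIcc 0 α, |Real.sin θ| ≤ Real.cos θ) ∧
      (∀ θ ∈ uIcc 0 α, 0 ≤ -(p.im * Real.sin θ)) ∧
      ‖p‖ / 2 ≤ p.re * Real.cos α - p.im * Real.sin α := by
    have hs : Real.sqrt 2 / 2 ≥ 1 / 2 := by
      have : 1 ≤ Real.sqrt 2 := Real.one_le_sqrt.2 (by norm_num)
      linarith
    have hn : ‖p‖ ≤ p.re + |p.im| := by
      have := Complex.norm_le_abs_re_add_abs_im p
      rwa [abs_of_pos hp] at this
    have hcs : ∀ θ, 0 ≤ θ → θ ≤ Real.pi / 4 → 0 ≤ Real.sin θ ∧ Real.sin θ ≤ Real.cos θ := by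
      intro θ h0 h1
      have a1 := Real.sin_le_sin_of_le_of_le_pi_div_two (by linarith) (by linarith) h1
      have a2 := Real.cos_le_cos_of_nonneg_of_le_pi h0 (by linarith) h1
      rw [Real.sin_pi_div_four] at a1
      rw [Real.cos_pi_div_four] at a2
      exact ⟨Real.sin_nonneg_of_nonneg_of_le_pi h0 (by linarith), a1.trans a2⟩
    rcases le_total p.im 0 with h | h
    · refine ⟨Real.pi / 4, (abs_of_pos (by positivity)).le, fun θ hθ => ?_, fun θ hθ => ?_, ?_⟩
      · rw [uIcc_of_le (by positivity)] at hθ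
        have := hcs θ hθ.1 hθ.2
        rw [abs_of_nonneg this.1]; exact this.2
      · rw [uIcc_of_le (by positivity)] at hθ
        have := (hcs θ hθ.1 hθ.2).1
        nlinarith
      · rw [Real.cos_pi_div_four, Real.sin_pi_div_four]
        rw [abs_of_nonpos h] at hn
        nlinarith
    · refine ⟨-(Real.pi / 4), by rw [abs_neg, abs_of_pos (by positivity)], fun θ hθ => ?_,
        fun θ hθ => ?_, ?_⟩
      · rw [uIcc_of_ge (by linarith)] at hθ
        have := hcs (-θ) (by linarith [hθ.2]) (by linarith [hθ.1])
        rw [Real.sin_neg, Real.cos_neg] at this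
        rw [abs_of_nonpos (by linarith)]; exact this.2
      · rw [uIcc_of_ge (by linarith)] at hθ
        have := (hcs (-θ) (by linarith [hθ.2]) (by linarith [hθ.1])).1
        rw [Real.sin_neg] at this
        nlinarith
      · rw [Real.cos_neg, Real.sin_neg, Real.cos_pi_div_four, Real.sin_pi_div_four]
        rw [abs_of_nonneg h] at hn
        nlinarith
  have hpre : ∀ r θ : ℝ, (p * (r * Complex.exp (θ * Complex.I))).re =
      r * (p.re * Real.cos θ - p.im * Real.sin θ) := by
    intro r θ
    rw [Complex.mul_re, Complex.re_ofReal_mul, Complex.im_ofReal_mul, Complex.exp_ofReal_mul_I_re,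
      Complex.exp_ofReal_mul_I_im]
    ring
  have hnr : ∀ r θ : ℝ, 0 < r → ‖(r : ℂ) * Complex.exp (θ * Complex.I)‖ = r := by
    intro r θ hr
    rw [norm_mul, Complex.norm_exp_ofReal_mul_I, mul_one, Complex.norm_real,
      Real.norm_of_nonneg hr.le]
  have hcos : ∀ θ ∈ uIcc 0 α, 1 / 2 ≤ Real.cos θ := by
    intro θ hθ
    have h1 := hθc θ hθ
    have h2 := Real.sin_sq_add_cos_sq θ
    have h3 : 0 ≤ Real.cos θ := (abs_nonneg _).trans h1
    rw [← sq_abs (Real.sin θ)] at h2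
    nlinarith [abs_nonneg (Real.sin θ)]
  have hbr : ∀ r : ℝ, 0 < r → ∀ θ ∈ uIcc 0 α,
      ‖h (r * Complex.exp (θ * Complex.I))‖ ≤ C * (r ^ N * (1 + r) ^ M) := by
    intro r hr θ hθ
    have := hb (r * Complex.exp (θ * Complex.I)) ?_ ?_
    · rwa [hnr r θ hr] at this
    · rw [Complex.re_ofReal_mul, Complex.exp_ofReal_mul_I_re]
      have := hcos θ hθ
      positivity
    · rw [Complex.re_ofReal_mul, Complex.exp_ofReal_mul_I_re, Complex.im_ofReal_mul,
        Complex.exp_ofReal_mul_I_im, abs_mul, abs_of_pos hr]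
      exact mul_le_mul_of_nonneg_left (hθc θ hθ) hr.le
  -- This bound degenerates as `Re p → 0`, but it only justifies the rotation and does not enter the
  -- final constant.
  have hrot := integral_Ioi_eq_rotate (g := fun z => h z * Complex.exp (-(p * z))) (α := α)
    (C := C * ((N + M + 2).factorial * Real.exp (p.re / 2) / (p.re / 2) ^ (N + M + 2)))
    (lt_of_le_of_lt hα (by linarith))
    (hd.mul (by fun_prop)) (fun r hr θ hθ => by
      have h2 := one_add_pow_mul_exp_le (N + M + 2) (half_pos hp) hr.le
      rw [norm_mul, Complex.norm_exp, Complex.neg_re, hpre]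
      have h3 : Real.exp (-(r * (p.re * Real.cos θ - p.im * Real.sin θ))) ≤
          Real.exp (-(p.re / 2 * r)) := by
        rw [Real.exp_le_exp]
        have h4 := hcos θ hθ
        have h5 := hsgn θ hθ
        have h6 : p.re / 2 ≤ p.re * Real.cos θ - p.im * Real.sin θ := by nlinarith
        nlinarith
      rw [le_div_iff₀ (by positivity)]
      calc ‖h (r * Complex.exp (θ * Complex.I))‖ *
            Real.exp (-(r * (p.re * Real.cos θ - p.im * Real.sin θ))) * (1 + r ^ 2)
          ≤ C * (r ^ N * (1 + r) ^ M) * Real.exp (-(p.re / 2 * r)) * (1 + r ^ 2) := by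
            gcongr; exact hbr r hr θ hθ
        _ ≤ C * ((1 + r) ^ N * (1 + r) ^ M) * Real.exp (-(p.re / 2 * r)) * (1 + r) ^ 2 := by
            gcongr
            · linarith
            · nlinarith
        _ = C * ((1 + r) ^ (N + M + 2) * Real.exp (-(p.re / 2 * r))) := by ring
        _ ≤ _ := by gcongr)
  rw [hrot, norm_mul, Complex.norm_exp_ofReal_mul_I, one_mul]
  have hp4 : 0 < ‖p‖ / 4 := by linarith
  have hle : ‖∫ r in Ioi (0 : ℝ), h (r * Complex.exp (α * Complex.I)) *
      Complex.exp (-(p * (r * Complex.exp (α * Complex.I))))‖ ≤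
      ∫ r in Ioi (0 : ℝ), C * B * (r ^ N * Real.exp (-(‖p‖ / 4 * r))) := by
    refine norm_integral_le_of_norm_le ((integrableOn_pow_mul_exp N hp4).const_mul _)
      ((ae_restrict_iff' measurableSet_Ioi).2 (Eventually.of_forall fun r hr => ?_))
    have hr : 0 < r := hr
    have h1 := hbr r hr α right_mem_uIcc
    have h2 := one_add_pow_mul_exp_le M (show 0 < δ / 4 by positivity) hr.le
    rw [norm_mul, Complex.norm_exp, Complex.neg_re, hpre]
    -- The rate `‖p‖/2` is split in two: `δ/4` absorbs `(1 + r)^M`, and `‖p‖/4` produces the power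
    -- of `‖p‖`.
    have h3 : Real.exp (-(r * (p.re * Real.cos α - p.im * Real.sin α))) ≤
        Real.exp (-(δ / 4 * r)) * Real.exp (-(‖p‖ / 4 * r)) := by
      rw [← Real.exp_add, Real.exp_le_exp]
      nlinarith
    calc _ ≤ C * (r ^ N * (1 + r) ^ M) *
          (Real.exp (-(δ / 4 * r)) * Real.exp (-(‖p‖ / 4 * r))) := by gcongr
      _ = C * ((1 + r) ^ M * Real.exp (-(δ / 4 * r))) * (r ^ N * Real.exp (-(‖p‖ / 4 * r))) := by
        ring
      _ ≤ _ := by gcongr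
  refine hle.trans (le_of_eq ?_)
  rw [integral_const_mul, integral_pow_mul_exp N hp4, div_pow]
  have : ‖p‖ ≠ 0 := (hδ.trans_le hδp).ne'
  field_simp

theorem HankelAdmissible.integrableOn {f : ℂ → ℂ} (hf : HankelAdmissible f) {p : ℂ}
    (hp : 0 < p.re) : IntegrableOn (fun x : ℝ => f x * Complex.exp (-(p * x))) (Ioi 0) := by
  obtain ⟨C, M, hC, hb⟩ := hf.remainder_bound 0
  refine integrableOn_mul_cexp_of_bound (N := 0) (M := M) hf.analytic.differentiableOn
    (fun z hz hz2 => ?_) hC hp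
  simpa [taylorSum] using hb z hz hz2

/-- Watson's lemma for the Laplace transform, uniformly in the right half plane. -/
theorem HankelAdmissible.laplace_expansion {f : ℂ → ℂ} (hf : HankelAdmissible f) (N : ℕ) {δ : ℝ}
    (hδ : 0 < δ) :
    ∃ D : ℝ, 0 ≤ D ∧ ∀ p : ℂ, 0 < p.re → δ ≤ ‖p‖ →
      ‖(∫ x in Ioi (0 : ℝ), f x * Complex.exp (-(p * x))) -
        ∑ k ∈ Finset.range N, iteratedDeriv k f 0 * (p ^ (k + 1))⁻¹‖ ≤ D / ‖p‖ ^ (N + 1) := by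
  obtain ⟨C, M, hC, hb⟩ := hf.remainder_bound N
  obtain ⟨D, hD, h⟩ := laplace_bound (h := fun z => f z - taylorSum f N z)
    (hf.analytic.differentiableOn.sub (differentiable_taylorSum f N).differentiableOn) hb hC hδ
  refine ⟨D, hD, fun p hp hp2 => ?_⟩
  have hi : ∀ k ∈ Finset.range N, IntegrableOn (fun x : ℝ => iteratedDeriv k f 0 / k.factorial *
      ((x : ℂ) ^ k * Complex.exp (-(p * x)))) (Ioi 0) :=
    fun k _ => (integrableOn_pow_mul_cexp k hp).const_mul _
  have e1 : ∀ x : ℝ, taylorSum f N x * Complex.exp (-(p * x)) = ∑ k ∈ Finset.range N,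
      iteratedDeriv k f 0 / k.factorial * ((x : ℂ) ^ k * Complex.exp (-(p * x))) := by
    intro x
    rw [taylorSum, Finset.sum_mul]
    exact Finset.sum_congr rfl fun k _ => by ring
  have e : (∫ x in Ioi (0 : ℝ), (f x - taylorSum f N x) * Complex.exp (-(p * x))) =
      (∫ x in Ioi (0 : ℝ), f x * Complex.exp (-(p * x))) -
        ∑ k ∈ Finset.range N, iteratedDeriv k f 0 * (p ^ (k + 1))⁻¹ := by
    simp only [sub_mul, e1]
    rw [integral_sub (hf.integrableOn hp) (integrable_finsetSum _ hi), integral_finsetSum _ hi]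
    congr 1
    refine Finset.sum_congr rfl fun k _ => ?_
    rw [integral_const_mul, integral_pow_mul_cexp k hp]
    have : (k.factorial : ℂ) ≠ 0 := by exact_mod_cast k.factorial_ne_zero
    field_simp
  rw [← e]
  exact h p hp hp2

/-! ### The Abel integral and the expansion of the Hankel transform -/

/-- The Laplace transform of `f`. -/
noncomputable def laplace (f : ℂ → ℂ) (p : ℂ) : ℂ :=
  ∫ x in Ioi (0 : ℝ), f x * Complex.exp (-(p * x))

/-- The density of the contour representation of `J_ν` on the steep circle. -/
noncomputable def contourDensity (ν : ℕ) (a : ℝ) : ℂ :=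
  (2 * Real.pi * Complex.I)⁻¹ * (deriv (circleMap (-3 / 4) (5 / 4)) a *
    circleMap (-3 / 4) (5 / 4) a ^ (-(ν : ℤ) - 1))

/-- `besselPhase` along the steep circle. -/
noncomputable def circlePhase (a : ℝ) : ℂ := besselPhase (circleMap (-3 / 4) (5 / 4) a)

theorem circleMap_mem_steepCircle (a : ℝ) : circleMap (-3 / 4) (5 / 4) a ∈ steepCircle :=
  circleMap_mem_sphere _ (by norm_num) a

theorem continuous_contourDensity (ν : ℕ) : Continuous (contourDensity ν) := by
  unfold contourDensity
  refine continuous_const.mul (Continuous.mul ?_ ?_)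
  · rw [show deriv (circleMap (-3 / 4) (5 / 4)) = _ from funext (deriv_circleMap _ _)]
    exact (continuous_circleMap _ _).mul continuous_const
  · exact (continuous_circleMap _ _).zpow₀ _ fun a =>
      Or.inl (ne_zero_of_mem_steepCircle (circleMap_mem_steepCircle a))

theorem continuous_circlePhase : Continuous circlePhase :=
  continuousOn_besselPhase.comp_continuous (continuous_circleMap _ _) circleMap_mem_steepCircle

theorem exists_contourDensity_bound (ν : ℕ) :
    ∃ B : ℝ, 0 ≤ B ∧ ∀ a ∈ uIoc 0 (2 * Real.pi), ‖contourDensity ν a‖ ≤ B := by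
  obtain ⟨B, hB⟩ := isCompact_uIcc.exists_bound_of_continuousOn
    (s := uIcc (0 : ℝ) (2 * Real.pi)) (continuous_contourDensity ν).continuousOn
  exact ⟨B, (norm_nonneg _).trans (hB 0 left_mem_uIcc), fun a ha => hB a (uIoc_subset_uIcc ha)⟩

theorem contourIntegral_eq (ν : ℕ) (F : ℂ → ℂ) :
    (∫ a in (0 : ℝ)..2 * Real.pi, contourDensity ν a * F (circlePhase a)) =
      (2 * Real.pi * Complex.I)⁻¹ *
        ∮ z in C(-3 / 4, 5 / 4), z ^ (-(ν : ℤ) - 1) * F (besselPhase z) := by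
  rw [circleIntegral, ← intervalIntegral.integral_const_mul]
  refine intervalIntegral.integral_congr fun a _ => ?_
  simp only [contourDensity, circlePhase, smul_eq_mul]
  ring

theorem besselJ_eq_contour (ν : ℕ) (x : ℝ) :
    (besselJ ν x : ℂ) =
      ∫ a in (0 : ℝ)..2 * Real.pi, contourDensity ν a * Complex.exp (-(x * circlePhase a)) := by
  rw [contourIntegral_eq ν fun q => Complex.exp (-(x * q)), besselJ_eq_circleIntegral]
  congr 2
  ext z
  ring

theorem norm_le_norm_ofReal_add {s : ℝ} (hs : 0 ≤ s) {z : ℂ} (hz : 0 ≤ z.re) : ‖z‖ ≤ ‖s + z‖ := by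
  rw [← sq_le_sq₀ (norm_nonneg _) (norm_nonneg _), ← Complex.normSq_eq_norm_sq,
    ← Complex.normSq_eq_norm_sq, Complex.normSq_apply, Complex.normSq_apply]
  simp only [Complex.add_re, Complex.ofReal_re, Complex.add_im, Complex.ofReal_im, zero_add]
  nlinarith [mul_nonneg hs hz]

theorem circlePhase_re_nonneg (a : ℝ) : 0 ≤ (circlePhase a).re :=
  besselPhase_re_nonneg (circleMap_mem_steepCircle a)

/-- The real part of the phase vanishes only at `±i`, and `circleMap` takes these values at
countably many parameters. -/
theorem ae_circlePhase_re_pos : ∀ᵐ a : ℝ, 0 < (circlePhase a).re := by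
  have h : ({Complex.I, -Complex.I} : Set ℂ).Countable := by simp
  have h2 := (h.preimage_circleMap (-3 / 4) (R := 5 / 4) (by norm_num)).ae_notMem volume
  exact h2.mono fun a ha => besselPhase_re_pos (circleMap_mem_steepCircle a) ha

theorem circlePhase_norm_ge {ω : ℝ} (hω : 0 < ω) (a : ℝ) : ω / 8 ≤ ‖(ω : ℂ) * circlePhase a‖ := by
  rw [norm_mul, Complex.norm_real, Real.norm_of_nonneg hω.le]
  have : 1 / 8 ≤ ‖circlePhase a‖ := besselPhase_norm_ge (circleMap_mem_steepCircle a)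
  nlinarith

/-- Because the phase has nonnegative real part, the kernel is dominated by `e^{-sx}` uniformly
along the circle; this licenses Fubini for `s > 0`. -/
theorem HankelAdmissible.integrable_contour {f : ℂ → ℂ} (hf : HankelAdmissible f)
    (ν : ℕ) {ω : ℝ} (hω : 0 < ω) {s : ℝ} (hs : 0 < s) :
    Integrable (fun z : ℝ × ℝ => contourDensity ν z.2 *
        (f z.1 * Complex.exp (-((s + ω * circlePhase z.2) * z.1))))
      ((volume.restrict (Ioi 0)).prod (volume.restrict (Ioc 0 (2 * Real.pi)))) := by
  obtain ⟨B, hB, hb⟩ := exists_contourDensity_bound ν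
  have h1 := hf.integrableOn (p := s) (by simpa using hs)
  have h2 : Integrable (fun _ : ℝ => B) (volume.restrict (Ioc 0 (2 * Real.pi))) :=
    integrable_const _
  refine (h1.norm.mul_prod h2).mono' ?_ ?_
  · have e : (fun z : ℝ × ℝ => contourDensity ν z.2 *
        (f z.1 * Complex.exp (-((s + ω * circlePhase z.2) * z.1)))) =
        fun z => (f z.1 * Complex.exp (-(s * z.1))) *
          (contourDensity ν z.2 * Complex.exp (-(ω * circlePhase z.2 * z.1))) := by
      ext z
      rw [show -(((s : ℂ) + ω * circlePhase z.2) * z.1) =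
        -(s * z.1) + -(ω * circlePhase z.2 * z.1) by ring, Complex.exp_add]
      ring
    rw [e]
    refine h1.aestronglyMeasurable.comp_fst.mul (Continuous.aestronglyMeasurable ?_)
    have := continuous_contourDensity ν
    have := continuous_circlePhase
    fun_prop
  · rw [Measure.prod_restrict]
    refine (ae_restrict_iff' (measurableSet_Ioi.prod measurableSet_Ioc)).2
      (Eventually.of_forall fun z hz => ?_)
    have hz1 : 0 < z.1 := hz.1
    rw [norm_mul, norm_mul, mul_comm]
    have h3 := hb z.2 (by rw [uIoc_of_le (by positivity)]; exact hz.2)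
    have h4 : ‖Complex.exp (-((s + ω * circlePhase z.2) * z.1))‖ ≤
        ‖Complex.exp (-((s : ℂ) * z.1))‖ := by
      rw [norm_cexp_neg_mul_ofReal, norm_cexp_neg_mul_ofReal, Real.exp_le_exp]
      have := circlePhase_re_nonneg z.2
      simp only [Complex.add_re, Complex.ofReal_re, Complex.re_ofReal_mul]
      have : 0 ≤ ω * (circlePhase z.2).re * z.1 := by positivity
      linarith
    rw [norm_mul]
    gcongr

theorem HankelAdmissible.integrableOn_hankelIntegrand {f : ℂ → ℂ} (hf : HankelAdmissible f)
    (ν : ℕ) {ω : ℝ} (hω : 0 < ω) {s : ℝ} (hs : 0 < s) :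
    IntegrableOn (fun x : ℝ => hankelIntegrand ν f ω x * (Real.exp (-s * x) : ℂ)) (Ioi 0) ∧
    ∫ x in Ioi (0 : ℝ), hankelIntegrand ν f ω x * (Real.exp (-s * x) : ℂ) =
      ∫ a in (0 : ℝ)..2 * Real.pi, contourDensity ν a * laplace f (s + ω * circlePhase a) := by
  have hi := hf.integrable_contour ν hω hs
  have e : ∀ x : ℝ, hankelIntegrand ν f ω x * (Real.exp (-s * x) : ℂ) =
      ∫ a in Ioc (0 : ℝ) (2 * Real.pi), contourDensity ν a *
        (f x * Complex.exp (-((s + ω * circlePhase a) * x))) := by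
    intro x
    rw [hankelIntegrand, besselJ_eq_contour, intervalIntegral.integral_of_le (by positivity),
      ← integral_const_mul, ← integral_mul_const]
    refine setIntegral_congr_fun measurableSet_Ioc fun a _ => ?_
    rw [show -(((s : ℂ) + ω * circlePhase a) * x) =
      -((ω * x : ℝ) * circlePhase a) + (-s * x : ℝ) by push_cast; ring, Complex.exp_add,
      Complex.ofReal_exp]
    ring
  simp only [e]
  refine ⟨hi.integral_prod_left, ?_⟩
  rw [integral_integral_swap hi, intervalIntegral.integral_of_le (by positivity)]
  refine setIntegral_congr_fun measurableSet_Ioc fun a _ => ?_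
  rw [integral_const_mul, laplace]

theorem HankelAdmissible.aestronglyMeasurable_contour {f : ℂ → ℂ} (hf : HankelAdmissible f)
    (ν : ℕ) {ω : ℝ} (hω : 0 < ω) {s : ℝ} (hs : 0 < s) :
    AEStronglyMeasurable (fun a => contourDensity ν a * laplace f (s + ω * circlePhase a))
      (volume.restrict (uIoc 0 (2 * Real.pi))) := by
  rw [uIoc_of_le (by positivity)]
  have := (hf.integrable_contour ν hω hs).integral_prod_right.aestronglyMeasurable
  refine this.congr (Eventually.of_forall fun a => ?_)
  simp only
  rw [integral_const_mul, laplace]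

theorem HankelAdmissible.tendsto_laplace {f : ℂ → ℂ} (hf : HankelAdmissible f) {p : ℂ} (hp : 0 < p.re) :
    Tendsto (fun s : ℝ => laplace f (s + p)) (𝓝[>] 0) (𝓝 (laplace f p)) := by
  have hev : ∀ᶠ s : ℝ in 𝓝[>] 0, 0 < s := eventually_mem_nhdsWithin
  refine tendsto_integral_filter_of_dominated_convergence
    (fun x : ℝ => ‖f x * Complex.exp (-(p * x))‖) ?_ ?_ (hf.integrableOn hp).norm ?_
  · filter_upwards [hev] with s hs
    exact (hf.integrableOn (p := s + p) (by simp; linarith)).aestronglyMeasurable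
  · filter_upwards [hev] with s hs
    refine (ae_restrict_iff' measurableSet_Ioi).2 (Eventually.of_forall fun x hx => ?_)
    have hx : 0 < x := hx
    rw [norm_mul, norm_mul, norm_cexp_neg_mul_ofReal, norm_cexp_neg_mul_ofReal]
    have : p.re ≤ (s + p).re := by simp [hs.le]
    refine mul_le_mul_of_nonneg_left (Real.exp_le_exp.2 ?_) (norm_nonneg _)
    nlinarith
  · refine Eventually.of_forall fun x => ?_
    have hc : Continuous fun s : ℝ => f x * Complex.exp (-((s + p) * x)) := by fun_prop
    have := hc.tendsto 0
    simp only [Complex.ofReal_zero, zero_add] at this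
    exact this.mono_left nhdsWithin_le_nhds

theorem HankelAdmissible.ae_tendsto_contour {f : ℂ → ℂ} (hf : HankelAdmissible f)
    (ν : ℕ) {ω : ℝ} (hω : 0 < ω) :
    ∀ᵐ a : ℝ, Tendsto (fun s : ℝ => contourDensity ν a * laplace f (s + ω * circlePhase a))
      (𝓝[>] 0) (𝓝 (contourDensity ν a * laplace f (ω * circlePhase a))) := by
  filter_upwards [ae_circlePhase_re_pos] with a ha
  refine (hf.tendsto_laplace ?_).const_mul _
  rw [Complex.re_ofReal_mul]
  positivity

theorem HankelAdmissible.intervalIntegrable_contour {f : ℂ → ℂ} (hf : HankelAdmissible f)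
    (ν : ℕ) {ω : ℝ} (hω : 0 < ω) :
    IntervalIntegrable (fun a => contourDensity ν a * laplace f (ω * circlePhase a)) volume
      0 (2 * Real.pi) := by
  obtain ⟨B, hB, hb⟩ := exists_contourDensity_bound ν
  -- With no terms, the expansion is the plain bound `D / ‖p‖` for the Laplace transform.
  obtain ⟨D, hD, hd⟩ := hf.laplace_expansion 0 (δ := ω / 8) (by positivity)
  have hm : AEStronglyMeasurable (fun a => contourDensity ν a * laplace f (ω * circlePhase a))
      (volume.restrict (uIoc 0 (2 * Real.pi))) := by
    -- Fubini gives measurability only for `s > 0`; at `s = 0` it is inherited as an almost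
    -- everywhere limit along `s = 1/(n+1)`.
    have hlim : Tendsto (fun n : ℕ => 1 / ((n : ℝ) + 1)) atTop (𝓝[>] 0) :=
      tendsto_nhdsWithin_iff.2 ⟨tendsto_one_div_add_atTop_nhds_zero_nat,
        Eventually.of_forall fun n => by simp only [mem_Ioi]; positivity⟩
    refine aestronglyMeasurable_of_tendsto_ae atTop (f := fun (n : ℕ) a => contourDensity ν a *
      laplace f ((1 / ((n : ℝ) + 1) : ℝ) + ω * circlePhase a))
      (fun n => hf.aestronglyMeasurable_contour ν hω (by positivity)) ?_
    exact ae_restrict_of_ae ((hf.ae_tendsto_contour ν hω).mono fun a ha => ha.comp hlim)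
  refine (intervalIntegrable_const (c := B * (D / (ω / 8)))).mono_fun' hm ?_
  refine (ae_restrict_iff' measurableSet_uIoc).2 ?_
  filter_upwards [ae_circlePhase_re_pos] with a ha ha2
  rw [norm_mul]
  refine mul_le_mul (hb a ha2) ?_ (norm_nonneg _) hB
  have h1 := circlePhase_norm_ge hω a
  have := hd (ω * circlePhase a) (by rw [Complex.re_ofReal_mul]; positivity) h1
  simp only [Finset.range_zero, Finset.sum_empty, sub_zero, zero_add, pow_one] at this
  exact this.trans (by gcongr)

/-- Adding `s > 0` to a number with nonnegative real part does not decrease its modulus, so the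
bound `D / ‖p‖` is uniform in `s` and dominated convergence applies on the contour. -/
theorem HankelAdmissible.hasAbelIntegral {f : ℂ → ℂ} (hf : HankelAdmissible f)
    (ν : ℕ) {ω : ℝ} (hω : 0 < ω) :
    HasAbelIntegral (hankelIntegrand ν f ω)
      (∫ a in (0 : ℝ)..2 * Real.pi, contourDensity ν a * laplace f (ω * circlePhase a)) := by
  refine ⟨fun s hs => (hf.integrableOn_hankelIntegrand ν hω hs).1, ?_⟩
  obtain ⟨B, hB, hb⟩ := exists_contourDensity_bound ν
  obtain ⟨D, hD, hd⟩ := hf.laplace_expansion 0 (δ := ω / 8) (by positivity)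
  have hev : ∀ᶠ s : ℝ in 𝓝[>] 0, 0 < s := eventually_mem_nhdsWithin
  refine Tendsto.congr' (f₁ := fun s : ℝ => ∫ a in (0 : ℝ)..2 * Real.pi, contourDensity ν a *
    laplace f (s + ω * circlePhase a))
    (hev.mono fun s hs => (hf.integrableOn_hankelIntegrand ν hω hs).2.symm) ?_
  refine intervalIntegral.tendsto_integral_filter_of_dominated_convergence
    (fun _ => B * (D / (ω / 8))) (hev.mono fun s hs => hf.aestronglyMeasurable_contour ν hω hs)
    (hev.mono fun s hs => ?_) intervalIntegrable_const
    ((hf.ae_tendsto_contour ν hω).mono fun a ha _ => ha)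
  filter_upwards [ae_circlePhase_re_pos] with a ha ha2
  rw [norm_mul]
  refine mul_le_mul (hb a ha2) ?_ (norm_nonneg _) hB
  have hre : 0 < ((ω : ℂ) * circlePhase a).re := by rw [Complex.re_ofReal_mul]; positivity
  have h1 := (circlePhase_norm_ge hω a).trans (norm_le_norm_ofReal_add hs.le hre.le)
  have := hd (s + ω * circlePhase a) (by rw [Complex.add_re, Complex.ofReal_re]; positivity) h1
  simp only [Finset.range_zero, Finset.sum_empty, sub_zero, zero_add, pow_one] at this
  exact this.trans (by gcongr)

theorem HankelAdmissible.hankelTransform_eq {f : ℂ → ℂ} (hf : HankelAdmissible f)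
    (ν : ℕ) {ω : ℝ} (hω : 0 < ω) :
    hankelTransform ν f ω =
      ∫ a in (0 : ℝ)..2 * Real.pi, contourDensity ν a * laplace f (ω * circlePhase a) :=
  (hf.hasAbelIntegral ν hω).2.limUnder_eq

/-- The Abel moment `∫₀^∞ x^k J_ν(x) dx`. -/
noncomputable def besselMoment (ν k : ℕ) : ℝ :=
  2 ^ k * (Real.Gamma (((ν : ℝ) + k + 1) / 2) / Real.Gamma (((ν : ℝ) - k + 1) / 2))

theorem integral_contour_inv_pow (ν k : ℕ) :
    (∫ a in (0 : ℝ)..2 * Real.pi, contourDensity ν a * (circlePhase a ^ (k + 1))⁻¹) =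
      besselMoment ν k / k.factorial := by
  have h := phaseMoment_eq_Gamma ν k
  rw [contourIntegral_eq ν fun q => (q ^ (k + 1))⁻¹, besselMoment, ← h, phaseMoment]
  have : (k.factorial : ℂ) ≠ 0 := by exact_mod_cast k.factorial_ne_zero
  field_simp

/-- The asymptotic expansion of the Hankel transform. -/
theorem HankelAdmissible.hankelTransform_expansion {f : ℂ → ℂ} (hf : HankelAdmissible f)
    (ν N : ℕ) :
    (fun ω : ℝ => hankelTransform ν f ω - ∑ k ∈ Finset.range N,
      iteratedDeriv k f 0 / k.factorial * besselMoment ν k / (ω : ℂ) ^ (k + 1))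
      =O[atTop] fun ω : ℝ => (ω ^ (N + 1))⁻¹ := by
  obtain ⟨B, hB, hb⟩ := exists_contourDensity_bound ν
  -- For `ω ≥ 1` the argument `ω q` has modulus at least `1/8`.
  obtain ⟨D, hD, hd⟩ := hf.laplace_expansion N (δ := 1 / 8) (by norm_num)
  refine IsBigO.of_bound (B * (D * 8 ^ (N + 1)) * (2 * Real.pi))
    ((eventually_ge_atTop 1).mono fun ω hω1 => ?_)
  have hω : 0 < ω := by linarith
  have hωC : (ω : ℂ) ≠ 0 := by exact_mod_cast hω.ne'
  have hc : ∀ k, Continuous fun a => contourDensity ν a * (circlePhase a ^ (k + 1))⁻¹ := fun k =>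
    (continuous_contourDensity ν).mul ((continuous_circlePhase.pow _).inv₀ fun a =>
      pow_ne_zero _ (besselPhase_ne_zero (circleMap_mem_steepCircle a)))
  have hi : ∀ k ∈ Finset.range N, IntervalIntegrable (fun a => iteratedDeriv k f 0 /
      (ω : ℂ) ^ (k + 1) * (contourDensity ν a * (circlePhase a ^ (k + 1))⁻¹)) volume
      0 (2 * Real.pi) := fun k _ => (continuous_const.mul (hc k)).intervalIntegrable _ _
  have hi2 := IntervalIntegrable.sum (Finset.range N) hi
  have e : hankelTransform ν f ω - ∑ k ∈ Finset.range N,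
      iteratedDeriv k f 0 / k.factorial * besselMoment ν k / (ω : ℂ) ^ (k + 1) =
      ∫ a in (0 : ℝ)..2 * Real.pi, (contourDensity ν a * laplace f (ω * circlePhase a) -
        ∑ k ∈ Finset.range N, iteratedDeriv k f 0 / (ω : ℂ) ^ (k + 1) *
          (contourDensity ν a * (circlePhase a ^ (k + 1))⁻¹)) := by
    rw [intervalIntegral.integral_sub (hf.intervalIntegrable_contour ν hω)
      (by simpa [Finset.sum_fn] using hi2),
      intervalIntegral.integral_finsetSum hi, hf.hankelTransform_eq ν hω]
    congr 1
    refine Finset.sum_congr rfl fun k _ => ?_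
    rw [intervalIntegral.integral_const_mul, integral_contour_inv_pow]
    ring
  rw [e]
  have h3 := intervalIntegral.norm_integral_le_of_norm_le (a := 0) (b := 2 * Real.pi)
    (μ := volume) (by positivity) (f := fun a => (contourDensity ν a * laplace f (ω * circlePhase a) -
        ∑ k ∈ Finset.range N, iteratedDeriv k f 0 / (ω : ℂ) ^ (k + 1) *
          (contourDensity ν a * (circlePhase a ^ (k + 1))⁻¹)))
    (g := fun _ => B * (D * 8 ^ (N + 1)) * (ω ^ (N + 1))⁻¹) ?_ intervalIntegrable_const
  · refine h3.trans (le_of_eq ?_)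
    rw [intervalIntegral.integral_const, sub_zero, smul_eq_mul, norm_inv, norm_pow,
      Real.norm_of_nonneg hω.le]
    ring
  · filter_upwards [ae_circlePhase_re_pos] with a ha ha2
    have h1 := circlePhase_norm_ge hω a
    have h2 := hd (ω * circlePhase a) (by rw [Complex.re_ofReal_mul]; positivity)
      (by linarith)
    have e2 : contourDensity ν a * laplace f (ω * circlePhase a) -
        ∑ k ∈ Finset.range N, iteratedDeriv k f 0 / (ω : ℂ) ^ (k + 1) *
          (contourDensity ν a * (circlePhase a ^ (k + 1))⁻¹) =
        contourDensity ν a * (laplace f (ω * circlePhase a) -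
          ∑ k ∈ Finset.range N, iteratedDeriv k f 0 * ((ω * circlePhase a) ^ (k + 1))⁻¹) := by
      rw [mul_sub, Finset.mul_sum]
      congr 1
      refine Finset.sum_congr rfl fun k _ => ?_
      rw [mul_pow, mul_inv]
      ring
    rw [e2, norm_mul, mul_assoc]
    refine mul_le_mul (hb a (by rwa [uIoc_of_le (by positivity)])) (h2.trans ?_) (norm_nonneg _) hB
    calc D / ‖(ω : ℂ) * circlePhase a‖ ^ (N + 1) ≤ D / (ω / 8) ^ (N + 1) := by gcongr
      _ = _ := by rw [div_pow]; field_simp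

/-! ### Orthogonal polynomials and Gaussian quadrature -/

/-- A positive weight function on `(0, ∞)` with finite moments. -/
structure IsPosWeight (w : ℝ → ℝ) : Prop where
  pos : ∀ x, 0 < x → 0 < w x
  integrable : ∀ k : ℕ, IntegrableOn (fun x => w x * x ^ k) (Ioi 0)

/-- The moment functional of a weight function. -/
noncomputable def momentForm (w : ℝ → ℝ) (p : ℝ[X]) : ℝ :=
  ∫ x in Ioi (0 : ℝ), w x * p.eval x

namespace IsPosWeight

variable {w : ℝ → ℝ}

theorem integrable_eval (hw : IsPosWeight w) (p : ℝ[X]) :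
    IntegrableOn (fun x => w x * p.eval x) (Ioi 0) := by
  have : (fun x => w x * p.eval x) = fun x => ∑ k ∈ Finset.range (p.natDegree + 1),
      p.coeff k * (w x * x ^ k) := by
    ext x
    rw [eval_eq_sum_range, Finset.mul_sum]
    exact Finset.sum_congr rfl fun k _ => by ring
  rw [this]
  exact integrable_finsetSum _ fun k _ => (hw.integrable k).const_mul _

theorem momentForm_add (hw : IsPosWeight w) (p q : ℝ[X]) :
    momentForm w (p + q) = momentForm w p + momentForm w q := by
  simp only [momentForm, eval_add, mul_add]
  exact integral_add (hw.integrable_eval p) (hw.integrable_eval q)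

theorem momentForm_sub (hw : IsPosWeight w) (p q : ℝ[X]) :
    momentForm w (p - q) = momentForm w p - momentForm w q := by
  simp only [momentForm, eval_sub, mul_sub]
  exact integral_sub (hw.integrable_eval p) (hw.integrable_eval q)

theorem momentForm_C_mul (a : ℝ) (p : ℝ[X]) : momentForm w (C a * p) = a * momentForm w p := by
  simp only [momentForm, eval_mul, eval_C, mul_left_comm]
  exact integral_const_mul _ _

theorem momentForm_sum {ι : Type*} (hw : IsPosWeight w) (s : Finset ι) (p : ι → ℝ[X]) :
    momentForm w (∑ i ∈ s, p i) = ∑ i ∈ s, momentForm w (p i) := by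
  simp only [momentForm, eval_finsetSum, Finset.mul_sum]
  exact integral_finsetSum _ fun i _ => hw.integrable_eval (p i)

/-- If the integral were zero, `p` would vanish almost everywhere on `(0, ∞)`, yet its root set is
finite. -/
theorem momentForm_pos (hw : IsPosWeight w) {p : ℝ[X]} (hp : p ≠ 0)
    (hnn : ∀ x, 0 < x → 0 ≤ p.eval x) : 0 < momentForm w p := by
  have h0 : 0 ≤ᵐ[volume.restrict (Ioi (0 : ℝ))] fun x => w x * p.eval x :=
    (ae_restrict_iff' measurableSet_Ioi).2
      (Eventually.of_forall fun x hx => mul_nonneg (hw.pos x hx).le (hnn x hx))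
  refine lt_of_le_of_ne (integral_nonneg_of_ae h0) fun h => ?_
  have h1 := (integral_eq_zero_iff_of_nonneg_ae h0 (hw.integrable_eval p)).1 h.symm
  have h2 : ∀ᵐ x ∂volume.restrict (Ioi (0 : ℝ)), x ∉ (p.roots.toFinset : Set ℝ) :=
    ae_restrict_of_ae (p.roots.toFinset.countable_toSet.ae_notMem volume)
  have h3 : ∀ᵐ x ∂volume.restrict (Ioi (0 : ℝ)), False := by
    filter_upwards [h1, h2, ae_restrict_mem measurableSet_Ioi] with x hx1 hx2 hx3
    rcases mul_eq_zero.1 hx1 with h | h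
    · exact (hw.pos x hx3).ne' h
    · exact hx2 (by simpa [hp] using h)
  rw [eventually_false_iff_eq_bot, ae_eq_bot, Measure.restrict_eq_zero, Real.volume_Ioi] at h3
  exact ENNReal.top_ne_zero h3

theorem orthoPoly_eq (w : ℝ → ℝ) (n : ℕ) :
    orthoPoly w n = X ^ n - ∑ m : Fin n, C (momentForm w (X ^ n * orthoPoly w m) /
      momentForm w (orthoPoly w m * orthoPoly w m)) * orthoPoly w m := by
  rw [orthoPoly]
  simp only [momentForm, eval_mul, eval_pow, eval_X, sq]

theorem orthoNorm_eq (w : ℝ → ℝ) (n : ℕ) :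
    orthoNorm w n = momentForm w (orthoPoly w n * orthoPoly w n) := by
  simp only [orthoNorm, momentForm, eval_mul, sq]

theorem monic_and_degree (w : ℝ → ℝ) (n : ℕ) :
    (orthoPoly w n).Monic ∧ (orthoPoly w n).degree = n := by
  induction n using Nat.strong_induction_on with
  | _ n ih =>
    have hlt : (∑ m : Fin n, C (momentForm w (X ^ n * orthoPoly w m) /
        momentForm w (orthoPoly w m * orthoPoly w m)) * orthoPoly w m).degree < n := by
      refine (degree_sum_le _ _).trans_lt ?_
      refine (Finset.sup_lt_iff (WithBot.bot_lt_coe n)).2 fun m _ => ?_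
      rw [← smul_eq_C_mul]
      refine (degree_smul_le _ _).trans_lt ?_
      rw [(ih m m.2).2]
      exact Nat.cast_lt.2 m.2
    rw [orthoPoly_eq]
    refine ⟨(monic_X_pow n).sub_of_left (by rwa [degree_X_pow]), ?_⟩
    rw [degree_sub_eq_left_of_degree_lt (by rwa [degree_X_pow]), degree_X_pow]

theorem monic (w : ℝ → ℝ) (n : ℕ) : (orthoPoly w n).Monic := (monic_and_degree w n).1

theorem degree_eq (w : ℝ → ℝ) (n : ℕ) : (orthoPoly w n).degree = n := (monic_and_degree w n).2

theorem natDegree_eq (w : ℝ → ℝ) (n : ℕ) : (orthoPoly w n).natDegree = n :=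
  natDegree_eq_of_degree_eq_some (degree_eq w n)

theorem momentForm_mul_self_pos (hw : IsPosWeight w) {p : ℝ[X]} (hp : p ≠ 0) :
    0 < momentForm w (p * p) :=
  hw.momentForm_pos (mul_ne_zero hp hp) fun x _ => by rw [eval_mul]; exact mul_self_nonneg _

theorem orthoNorm_pos (hw : IsPosWeight w) (n : ℕ) : 0 < orthoNorm w n := by
  rw [orthoNorm_eq]
  exact hw.momentForm_mul_self_pos (monic w n).ne_zero

theorem orthogonal (hw : IsPosWeight w) (n : ℕ) :
    ∀ m < n, momentForm w (orthoPoly w n * orthoPoly w m) = 0 := by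
  induction n using Nat.strong_induction_on with
  | _ n ih =>
    intro m hm
    rw [orthoPoly_eq, sub_mul, hw.momentForm_sub, Finset.sum_mul, hw.momentForm_sum,
      Finset.sum_eq_single ⟨m, hm⟩]
    · rw [mul_assoc, momentForm_C_mul, div_mul_cancel₀, sub_self]
      exact (hw.momentForm_mul_self_pos (monic w m).ne_zero).ne'
    · intro j _ hj
      rw [mul_assoc, momentForm_C_mul]
      rcases lt_trichotomy (j : ℕ) m with h | h | h
      · rw [mul_comm (orthoPoly w j) (orthoPoly w m), ih m hm j h, mul_zero]
      · exact absurd (Fin.ext h) hj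
      · rw [ih j j.2 m h, mul_zero]
    · simp

theorem orthogonal_of_degree_lt (hw : IsPosWeight w) {n : ℕ} {q : ℝ[X]} (hq : q.degree < n) :
    momentForm w (orthoPoly w n * q) = 0 := by
  have key : ∀ d ≤ n, ∀ q : ℝ[X], q.degree < d → momentForm w (orthoPoly w n * q) = 0 := by
    intro d
    induction d with
    | zero =>
      intro _ q hq
      have : q = 0 := by
        rw [← degree_eq_bot]
        exact Nat.WithBot.lt_zero_iff.1 (by simpa using hq)
      rw [this, mul_zero]
      simp [momentForm]
    | succ d ih =>
      intro hd q hq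
      have e : orthoPoly w n * q = orthoPoly w n * (q - C (q.coeff d) * orthoPoly w d) +
          C (q.coeff d) * (orthoPoly w n * orthoPoly w d) := by ring
      rw [e, hw.momentForm_add, momentForm_C_mul, hw.orthogonal n d (by omega), mul_zero, add_zero]
      refine ih (by omega) _ ?_
      rw [degree_lt_iff_coeff_zero]
      intro m hm
      rw [coeff_sub, coeff_C_mul]
      rcases hm.eq_or_lt with rfl | hm
      · have := (monic w d).coeff_natDegree
        rw [natDegree_eq] at this
        rw [this, mul_one, sub_self]
      · have h1 : q.coeff m = 0 :=
          coeff_eq_zero_of_degree_lt (hq.trans_le (by exact_mod_cast hm))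
        have h2 : (orthoPoly w d).coeff m = 0 :=
          coeff_eq_zero_of_degree_lt (by rw [degree_eq]; exact_mod_cast hm)
        rw [h1, h2, mul_zero, sub_zero]
  exact key n le_rfl q hq

/-- An orthogonal polynomial has no nonconstant factor that is nonnegative on `(0, ∞)`. -/
theorem not_dvd_of_nonneg (hw : IsPosWeight w) {n : ℕ} {s : ℝ[X]} (hs : 1 ≤ s.natDegree)
    (hnn : ∀ x, 0 < x → 0 ≤ s.eval x) : ¬ s ∣ orthoPoly w n := by
  rintro ⟨q, hq⟩
  have hφ := (monic w n).ne_zero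
  have hs0 : s ≠ 0 := by rintro rfl; simp at hs
  have hq0 : q ≠ 0 := by rintro rfl; rw [mul_zero] at hq; exact hφ hq
  have hdeg : s.natDegree + q.natDegree = n := by
    rw [← natDegree_mul hs0 hq0, ← hq, natDegree_eq]
  -- If `φ_n = s q` with `s` nonconstant then `deg q < n`, so `φ_n` is orthogonal to `q`; but `φ_n q
  -- = s q²` is nonnegative and has positive integral.
  have h1 := hw.orthogonal_of_degree_lt (n := n) (q := q)
    (by rw [degree_eq_natDegree hq0]; exact_mod_cast (by omega))
  have h2 := hw.momentForm_pos (p := orthoPoly w n * q) (mul_ne_zero hφ hq0) fun x hx => by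
    rw [hq, eval_mul, eval_mul, mul_assoc]
    exact mul_nonneg (hnn x hx) (mul_self_nonneg _)
  exact h2.ne' h1

theorem pos_of_mem_gaussNodes (hw : IsPosWeight w) {n : ℕ} {x : ℝ} (hx : x ∈ gaussNodes w n) :
    0 < x := by
  rw [gaussNodes, Multiset.mem_toFinset, mem_roots (monic w n).ne_zero] at hx
  by_contra! h
  refine hw.not_dvd_of_nonneg (s := X - C x) (by simp) (fun y hy => ?_) (dvd_iff_isRoot.2 hx)
  simp only [eval_sub, eval_X, eval_C]
  linarith

theorem nodup_roots (hw : IsPosWeight w) (n : ℕ) : (orthoPoly w n).roots.Nodup := by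
  rw [Multiset.nodup_iff_count_le_one]
  intro a
  rw [count_roots]
  by_contra! h
  refine hw.not_dvd_of_nonneg (s := (X - C a) ^ 2) (by simp) (fun y hy => ?_)
    ((le_rootMultiplicity_iff (monic w n).ne_zero).1 h)
  rw [eval_pow]
  exact sq_nonneg _

/-- The cofactor of the linear factors has no real root, hence constant sign; were it nonconstant,
it or its negative would be a forbidden nonnegative factor. -/
theorem card_gaussNodes (hw : IsPosWeight w) (n : ℕ) : (gaussNodes w n).card = n := by
  rw [gaussNodes, Multiset.toFinset_card_of_nodup (hw.nodup_roots n)]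
  obtain ⟨q, hq1, hq2, hq3⟩ := exists_prod_multiset_X_sub_C_mul (orthoPoly w n)
  rw [natDegree_eq] at hq2
  by_contra hne
  have hdeg : 1 ≤ q.natDegree := by omega
  have hq0 : q ≠ 0 := by rintro rfl; simp at hdeg
  have hroot : ∀ x, q.eval x ≠ 0 := fun x hx => by
    have : x ∈ q.roots := (mem_roots hq0).2 hx
    simp [hq3] at this
  have hdvd : q ∣ orthoPoly w n := ⟨_, by rw [← hq1]; ring⟩
  rcases lt_or_gt_of_ne (hroot 0) with h0 | h0
  · refine hw.not_dvd_of_nonneg (s := -q) (by simpa using hdeg) (fun x hx => ?_) (neg_dvd.2 hdvd)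
    rw [eval_neg]
    by_contra! h
    obtain ⟨c, -, hc⟩ := intermediate_value_Icc hx.le q.continuous.continuousOn
      ⟨h0.le, by linarith⟩
    exact hroot c hc
  · refine hw.not_dvd_of_nonneg hdeg (fun x hx => ?_) hdvd
    by_contra! h
    obtain ⟨c, -, hc⟩ := intermediate_value_Icc' hx.le q.continuous.continuousOn ⟨h.le, h0.le⟩
    exact hroot c hc

theorem eval_gaussNodes {n : ℕ} {x : ℝ} (hx : x ∈ gaussNodes w n) : (orthoPoly w n).eval x = 0 := by
  rw [gaussNodes, Multiset.mem_toFinset, mem_roots (monic w n).ne_zero] at hx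
  exact hx

/-- The interpolatory quadrature rule on the Gaussian nodes is exact up to degree `2n - 1`. -/
theorem momentForm_eq_sum_basis (hw : IsPosWeight w) {n : ℕ} {p : ℝ[X]}
    (hp : p.natDegree < 2 * n) :
    momentForm w p = ∑ x ∈ gaussNodes w n,
      momentForm w (Lagrange.basis (gaussNodes w n) id x) * p.eval x := by
  have hm := monic w n
  -- The quotient of `p` by `φ_n` has degree below `n`, so orthogonality removes it; the remainder
  -- agrees with `p` at the nodes and equals its own Lagrange interpolant.
  set r := p %ₘ orthoPoly w n with hr
  have hdiv := modByMonic_add_div p (orthoPoly w n)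
  have hdeg : (p /ₘ orthoPoly w n).degree < n := by
    refine degree_le_natDegree.trans_lt ?_
    rw [natDegree_divByMonic p hm, natDegree_eq]
    exact_mod_cast (by omega)
  have h1 : momentForm w p = momentForm w r := by
    conv_lhs => rw [← hdiv]
    rw [hw.momentForm_add, hw.orthogonal_of_degree_lt hdeg, add_zero]
  have hrdeg : r.degree < (gaussNodes w n).card := by
    rw [hw.card_gaussNodes, ← degree_eq w n]
    exact degree_modByMonic_lt p hm
  have heval : ∀ x ∈ gaussNodes w n, r.eval x = p.eval x := by
    intro x hx
    conv_rhs => rw [← hdiv]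
    rw [eval_add, eval_mul, eval_gaussNodes hx, zero_mul, add_zero]
  rw [h1, Lagrange.eq_interpolate (s := gaussNodes w n) (v := id) (injOn_id _) hrdeg,
    Lagrange.interpolate_apply, hw.momentForm_sum]
  refine Finset.sum_congr rfl fun x hx => ?_
  rw [momentForm_C_mul, id, heval x hx, mul_comm]

/-- Exactness is tested on `φ_{n-1} q` with `q = φ_n / (X - x)`. Only the node `x` contributes, with
`q(x) = φ_n'(x)`, while the integral is `τ_{n-1}` because `q` is monic of degree `n - 1`. -/
theorem momentForm_basis (hw : IsPosWeight w) {n : ℕ} (hn : 1 ≤ n) {x : ℝ}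
    (hx : x ∈ gaussNodes w n) :
    momentForm w (Lagrange.basis (gaussNodes w n) id x) = gaussWeight w n x := by
  obtain ⟨q, hq⟩ := dvd_iff_isRoot.2 (eval_gaussNodes hx)
  have hqm : q.Monic := (monic_X_sub_C x).of_mul_monic_left (hq ▸ monic w n)
  have hqd : q.natDegree = n - 1 := by
    have := natDegree_eq w n
    rw [hq, (monic_X_sub_C x).natDegree_mul hqm, natDegree_X_sub_C] at this
    omega
  have hqx : q.eval x = (derivative (orthoPoly w n)).eval x := by
    rw [hq]; simp
  have hsub : (q - orthoPoly w (n - 1)).degree < (n - 1 : ℕ) := by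
    have := degree_sub_lt_left (p := q) (q := orthoPoly w (n - 1))
      (by rw [degree_eq, degree_eq_natDegree hqm.ne_zero, hqd]) hqm.ne_zero
      (by rw [hqm.leadingCoeff, (monic w (n - 1)).leadingCoeff])
    rwa [degree_eq_natDegree hqm.ne_zero, hqd] at this
  have h1 : momentForm w (orthoPoly w (n - 1) * q) = orthoNorm w (n - 1) := by
    have e : orthoPoly w (n - 1) * q = orthoPoly w (n - 1) * (q - orthoPoly w (n - 1)) +
      orthoPoly w (n - 1) * orthoPoly w (n - 1) := by ring
    rw [e, hw.momentForm_add, hw.orthogonal_of_degree_lt hsub, zero_add, orthoNorm_eq]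
  have h2 := hw.momentForm_eq_sum_basis (n := n) (p := orthoPoly w (n - 1) * q) (by
    rw [(monic w (n - 1)).natDegree_mul hqm, natDegree_eq, hqd]; omega)
  rw [Finset.sum_eq_single x, h1, eval_mul, hqx] at h2
  · have hτ := (hw.orthoNorm_pos (n - 1)).ne'
    rw [gaussWeight, eq_div_iff]
    · rw [h2]; ring
    · intro h
      rw [mul_comm] at h
      rw [h, mul_zero] at h2
      exact hτ h2
  · intro y hy hyx
    have := eval_gaussNodes hy
    rw [hq, eval_mul, eval_sub, eval_X, eval_C] at this
    rw [eval_mul, (mul_eq_zero.1 this).resolve_left (sub_ne_zero.2 hyx), mul_zero, mul_zero]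
  · exact fun h => absurd hx h

/-- Exactness of the Gaussian quadrature rule on monomials. -/
theorem sum_gaussWeight_pow (hw : IsPosWeight w) {n l : ℕ} (hl : l < 2 * n) :
    ∑ x ∈ gaussNodes w n, gaussWeight w n x * x ^ l = ∫ x in Ioi (0 : ℝ), w x * x ^ l := by
  have h := hw.momentForm_eq_sum_basis (n := n) (p := X ^ l) (by rwa [natDegree_X_pow])
  simp only [eval_pow, eval_X] at h
  have e : momentForm w (X ^ l) = ∫ x in Ioi (0 : ℝ), w x * x ^ l := by simp [momentForm]
  rw [← e, h]
  exact Finset.sum_congr rfl fun x hx => by rw [hw.momentForm_basis (by omega) hx]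

end IsPosWeight

/-! ### Moments of the Bessel weight -/

/-- The integrand in the definition of `K_ν(√x)`. -/
noncomputable def besselKKernel (ν : ℕ) (x t : ℝ) : ℝ :=
  Real.exp (-t - x / (4 * t)) / t ^ (ν + 1)

theorem besselK_sqrt (ν : ℕ) {x : ℝ} (hx : 0 < x) :
    besselK ν (Real.sqrt x) =
      (1 / 2) * (Real.sqrt x / 2) ^ ν * ∫ t in Ioi (0 : ℝ), besselKKernel ν x t := by
  rw [besselK, Real.sq_sqrt hx.le]
  rfl

theorem measurable_besselKKernel (ν : ℕ) :
    Measurable fun z : ℝ × ℝ => besselKKernel ν z.1 z.2 := by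
  unfold besselKKernel
  fun_prop

/-- The singularity `t^(-ν-1)` is cancelled by `exp(-x/(4t)) ≤ (ν+1)! (4t/x)^(ν+1)`, leaving a
multiple of `e^{-t}`. -/
theorem integrableOn_besselKKernel (ν : ℕ) {x : ℝ} (hx : 0 < x) :
    IntegrableOn (besselKKernel ν x) (Ioi 0) := by
  have hi : IntegrableOn (fun t : ℝ => (ν + 1).factorial / (x / 4) ^ (ν + 1) * Real.exp (-t))
      (Ioi 0) := (integrableOn_exp_neg_Ioi 0).const_mul _
  refine hi.mono' ((measurable_besselKKernel ν).comp measurable_prodMk_left).aestronglyMeasurable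
    ((ae_restrict_iff' measurableSet_Ioi).2 (Eventually.of_forall fun t ht => ?_))
  have ht : 0 < t := ht
  have h := Real.pow_div_factorial_le_exp (x / (4 * t)) (by positivity) (ν + 1)
  rw [besselKKernel, Real.norm_of_nonneg (by positivity), sub_eq_add_neg, Real.exp_add,
    Real.exp_neg (x / (4 * t)), div_le_iff₀ (by positivity)]
  rw [div_le_iff₀ (by positivity)] at h
  have e : (x / (4 * t)) ^ (ν + 1) = (x / 4) ^ (ν + 1) / t ^ (ν + 1) := by
    rw [← div_pow]; congr 1; field_simp
  rw [e, div_le_iff₀ (by positivity)] at h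
  have h2 := Real.exp_pos (x / (4 * t))
  calc Real.exp (-t) * (Real.exp (x / (4 * t)))⁻¹
      = Real.exp (-t) * ((x / 4) ^ (ν + 1) / (x / 4) ^ (ν + 1)) * (Real.exp (x / (4 * t)))⁻¹ := by
        rw [div_self (by positivity), mul_one]
    _ = Real.exp (-t) * (x / 4) ^ (ν + 1) / (x / 4) ^ (ν + 1) * (Real.exp (x / (4 * t)))⁻¹ := by
        ring
    _ ≤ Real.exp (-t) * (Real.exp (x / (4 * t)) * (ν + 1).factorial * t ^ (ν + 1)) /
        (x / 4) ^ (ν + 1) * (Real.exp (x / (4 * t)))⁻¹ := by gcongr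
    _ = _ := by field_simp

theorem integral_besselKKernel_pos (ν : ℕ) {x : ℝ} (hx : 0 < x) :
    0 < ∫ t in Ioi (0 : ℝ), besselKKernel ν x t := by
  have hpos : ∀ t ∈ Ioi (0 : ℝ), 0 < besselKKernel ν x t := fun t ht => by
    have ht : 0 < t := ht
    unfold besselKKernel
    positivity
  rw [setIntegral_pos_iff_support_of_nonneg_ae
    ((ae_restrict_iff' measurableSet_Ioi).2 (Eventually.of_forall fun t ht => (hpos t ht).le))
    (integrableOn_besselKKernel ν hx)]
  have : Ioi (0 : ℝ) ⊆ Function.support (besselKKernel ν x) ∩ Ioi 0 :=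
    fun t ht => ⟨(hpos t ht).ne', ht⟩
  refine lt_of_lt_of_le ?_ (measure_mono this)
  rw [Real.volume_Ioi]
  exact ENNReal.zero_lt_top

/-- The Mellin transform of the kernel. -/
theorem mellin_besselKKernel (ν : ℕ) {a : ℝ} (ha : (ν : ℝ) < a) :
    IntegrableOn (fun x => x ^ (a - 1) * ∫ t in Ioi (0 : ℝ), besselKKernel ν x t) (Ioi 0) ∧
    ∫ x in Ioi (0 : ℝ), x ^ (a - 1) * (∫ t in Ioi (0 : ℝ), besselKKernel ν x t) =
      4 ^ a * Real.Gamma a * Real.Gamma (a - ν) := by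
  have ha0 : 0 < a := lt_of_le_of_lt (Nat.cast_nonneg ν) ha
  have hm : Measurable fun z : ℝ × ℝ => z.1 ^ (a - 1) * besselKKernel ν z.1 z.2 :=
    (measurable_fst.pow_const _).mul (measurable_besselKKernel ν)
  have hfac : ∀ x t : ℝ, x ^ (a - 1) * besselKKernel ν x t =
      (Real.exp (-t) / t ^ (ν + 1)) * (x ^ (a - 1) * Real.exp (-((4 * t)⁻¹ * x))) := by
    intro x t
    rw [besselKKernel, show -t - x / (4 * t) = -t + -((4 * t)⁻¹ * x) by ring, Real.exp_add]
    ring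
  -- Integrating in `x` first gives a Gamma integral and leaves another one in `t`; positivity of
  -- the integrand justifies the swap.
  have hin : ∀ t : ℝ, 0 < t → ∫ x in Ioi (0 : ℝ), x ^ (a - 1) * besselKKernel ν x t =
      4 ^ a * Real.Gamma a * (Real.exp (-t) * t ^ (a - ν - 1)) := by
    intro t ht
    simp only [hfac]
    rw [integral_const_mul, Real.integral_rpow_mul_exp_neg_mul_Ioi ha0 (by positivity), one_div,
      inv_inv, Real.mul_rpow (by norm_num) ht.le, sub_sub, Real.rpow_sub ht, ← Nat.cast_add_one,
      Real.rpow_natCast]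
    ring
  have hi1 : ∀ t : ℝ, 0 < t → IntegrableOn (fun x => x ^ (a - 1) * besselKKernel ν x t) (Ioi 0) := by
    intro t ht
    simp only [hfac]
    have := integrableOn_rpow_mul_exp_neg_mul_rpow (p := 1) (s := a - 1) (b := (4 * t)⁻¹)
      (by linarith) one_pos (by positivity)
    simp only [Real.rpow_one, neg_mul] at this
    exact this.const_mul _
  have hi2 : IntegrableOn (fun t : ℝ => 4 ^ a * Real.Gamma a * (Real.exp (-t) * t ^ (a - ν - 1)))
      (Ioi 0) := (Real.GammaIntegral_convergent (by linarith)).const_mul _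
  have hprod : Integrable (fun z : ℝ × ℝ => z.1 ^ (a - 1) * besselKKernel ν z.1 z.2)
      ((volume.restrict (Ioi 0)).prod (volume.restrict (Ioi 0))) := by
    rw [integrable_prod_iff' hm.aestronglyMeasurable]
    refine ⟨(ae_restrict_iff' measurableSet_Ioi).2 (Eventually.of_forall hi1), ?_⟩
    refine IntegrableOn.congr_fun hi2 (fun t ht => ?_) measurableSet_Ioi
    have ht : 0 < t := ht
    simp only
    rw [← hin t ht]
    refine setIntegral_congr_fun measurableSet_Ioi fun x hx => ?_
    have hx : 0 < x := hx
    have : 0 ≤ x ^ (a - 1) * besselKKernel ν x t := by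
      unfold besselKKernel
      positivity
    exact (Real.norm_of_nonneg this).symm
  have e : ∀ x : ℝ, x ^ (a - 1) * (∫ t in Ioi (0 : ℝ), besselKKernel ν x t) =
      ∫ t in Ioi (0 : ℝ), x ^ (a - 1) * besselKKernel ν x t := fun x => (integral_const_mul _ _).symm
  simp only [e]
  refine ⟨hprod.integral_prod_left, ?_⟩
  rw [integral_integral_swap hprod, setIntegral_congr_fun measurableSet_Ioi hin,
    integral_const_mul, ← Real.Gamma_eq_integral (by linarith)]

/-- `κ` as a natural number, together with the form of the weight function. -/
theorem exists_kappa {μ ν : ℕ} (h : ν ≤ μ) : ∃ d : ℕ, kappa μ ν = ((ν + 2 * d : ℕ) : ℝ) ∧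
    (ν + 2 * d = if Even (μ - ν) then μ else μ + 1) ∧
    ∀ x, weightFun μ ν x =
      besselK ν (Real.sqrt x) / 2 * x ^ ((((ν + 2 * d : ℕ) : ℝ) - 1) / 2) := by
  -- In both cases `κ - ν` is even, so from here on `κ = ν + 2d` treats the two parities together.
  by_cases he : Even (μ - ν)
  · obtain ⟨d, hd⟩ := he
    have e : ν + 2 * d = μ := by omega
    refine ⟨d, ?_, ?_, fun x => ?_⟩
    · rw [kappa, if_pos ⟨d, hd⟩, e]
    · rw [if_pos ⟨d, hd⟩, e]
    · rw [weightFun, if_pos ⟨d, hd⟩, e]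
  · obtain ⟨d, hd⟩ := Nat.not_even_iff_odd.1 he
    have e : ν + 2 * (d + 1) = μ + 1 := by omega
    refine ⟨d + 1, ?_, ?_, fun x => ?_⟩
    · rw [kappa, if_neg he, e]; push_cast; ring
    · rw [if_neg he, e]
    · rw [weightFun, if_neg he, e]
      congr 2
      push_cast
      ring

theorem weightFun_mul_pow {μ ν d : ℕ} (hd : ∀ x, weightFun μ ν x =
      besselK ν (Real.sqrt x) / 2 * x ^ ((((ν + 2 * d : ℕ) : ℝ) - 1) / 2)) (l : ℕ) {x : ℝ}
    (hx : 0 < x) : weightFun μ ν x * x ^ l = 1 / 4 * (1 / 2) ^ ν *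
      (x ^ (((ν + d + l : ℕ) : ℝ) + 1 / 2 - 1) * ∫ t in Ioi (0 : ℝ), besselKKernel ν x t) := by
  have e : (Real.sqrt x) ^ ν * x ^ ((((ν + 2 * d : ℕ) : ℝ) - 1) / 2) * x ^ l =
      x ^ (((ν + d + l : ℕ) : ℝ) + 1 / 2 - 1) := by
    rw [Real.sqrt_eq_rpow, ← Real.rpow_natCast, ← Real.rpow_mul hx.le, ← Real.rpow_natCast x l,
      ← Real.rpow_add hx, ← Real.rpow_add hx]
    congr 1
    push_cast
    ring
  rw [hd, besselK_sqrt ν hx, ← e, div_pow, one_div_pow]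
  ring

theorem isPosWeight_weightFun {μ ν : ℕ} (h : ν ≤ μ) : IsPosWeight (weightFun μ ν) := by
  obtain ⟨d, -, -, hd⟩ := exists_kappa h
  refine ⟨fun x hx => ?_, fun k => ?_⟩
  · have := integral_besselKKernel_pos ν hx
    rw [hd, besselK_sqrt ν hx]
    positivity
  · have := (mellin_besselKKernel ν (a := ((ν + d + k : ℕ) : ℝ) + 1 / 2)
      (by push_cast; linarith [Nat.cast_nonneg (α := ℝ) d, Nat.cast_nonneg (α := ℝ) k])).1
    refine (this.const_mul (1 / 4 * (1 / 2) ^ ν)).congr ?_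
    exact (ae_restrict_iff' measurableSet_Ioi).2
      (Eventually.of_forall fun x hx => (weightFun_mul_pow hd k hx).symm)

theorem integral_weightFun_mul_pow {μ ν d : ℕ} (hd : ∀ x, weightFun μ ν x =
      besselK ν (Real.sqrt x) / 2 * x ^ ((((ν + 2 * d : ℕ) : ℝ) - 1) / 2)) (l : ℕ) :
    ∫ x in Ioi (0 : ℝ), weightFun μ ν x * x ^ l =
      1 / 2 * 2 ^ (ν + 2 * (d + l)) * Real.Gamma (((ν + d + l : ℕ) : ℝ) + 1 / 2) *
        Real.Gamma (((d + l : ℕ) : ℝ) + 1 / 2) := by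
  have h := (mellin_besselKKernel ν (a := ((ν + d + l : ℕ) : ℝ) + 1 / 2)
      (by push_cast; linarith [Nat.cast_nonneg (α := ℝ) d, Nat.cast_nonneg (α := ℝ) l])).2
  rw [setIntegral_congr_fun measurableSet_Ioi fun x hx => weightFun_mul_pow hd l hx,
    integral_const_mul, h, Real.rpow_add (by norm_num), Real.rpow_natCast, ← Real.sqrt_eq_rpow,
    show (4 : ℝ) = 2 ^ 2 by norm_num, Real.sqrt_sq (by norm_num)]
  have e : ((ν + d + l : ℕ) : ℝ) + 1 / 2 - ν = ((d + l : ℕ) : ℝ) + 1 / 2 := by push_cast; ring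
  rw [e, one_div_pow]
  have e2 : ((2 : ℝ) ^ 2) ^ (ν + d + l) = 2 ^ ν * 2 ^ (ν + 2 * (d + l)) := by
    rw [← pow_mul, ← pow_add]; congr 1; ring
  rw [e2]
  field_simp

/-- The moments of the weight function and the Abel moments of the Bessel function agree. -/
theorem besselMoment_eq_integral {μ ν d : ℕ} (hd : ∀ x, weightFun μ ν x =
      besselK ν (Real.sqrt x) / 2 * x ^ ((((ν + 2 * d : ℕ) : ℝ) - 1) / 2)) (l : ℕ) :
    besselMoment ν (ν + 2 * (d + l)) =
      2 / Real.pi * Real.cos (((ν + 2 * (d + l) : ℕ) - (ν : ℝ)) * Real.pi / 2) *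
        ∫ x in Ioi (0 : ℝ), weightFun μ ν x * x ^ l := by
  rw [integral_weightFun_mul_pow hd, besselMoment]
  have e1 : ((ν : ℝ) + (ν + 2 * (d + l) : ℕ) + 1) / 2 = ((ν + d + l : ℕ) : ℝ) + 1 / 2 := by
    push_cast; ring
  have e2 : ((ν : ℝ) - (ν + 2 * (d + l) : ℕ) + 1) / 2 = 1 - (((d + l : ℕ) : ℝ) + 1 / 2) := by
    push_cast; ring
  have e3 : ((ν + 2 * (d + l) : ℕ) - (ν : ℝ)) * Real.pi / 2 = ((d + l : ℕ) : ℝ) * Real.pi := by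
    push_cast; ring
  rw [e1, e2, e3]
  set y : ℝ := ((d + l : ℕ) : ℝ) + 1 / 2 with hy
  -- The reflection formula exchanges the `1/Γ(1-y)` of the Abel moment for the `Γ(y)` of the weight
  -- moment; here `sin(πy) = cos((d+l)π) = ±1`.
  have hG := Real.Gamma_mul_Gamma_one_sub y
  have hsin : Real.sin (Real.pi * y) = Real.cos (((d + l : ℕ) : ℝ) * Real.pi) := by
    rw [hy, show Real.pi * (((d + l : ℕ) : ℝ) + 1 / 2) = ((d + l : ℕ) : ℝ) * Real.pi + Real.pi / 2 by
      ring, Real.sin_add_pi_div_two]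
  have hcos : Real.cos (((d + l : ℕ) : ℝ) * Real.pi) ^ 2 = 1 := by
    have h := Real.sin_sq_add_cos_sq (((d + l : ℕ) : ℝ) * Real.pi)
    rw [Real.sin_nat_mul_pi] at h
    linarith
  rw [hsin] at hG
  set c := Real.cos (((d + l : ℕ) : ℝ) * Real.pi) with hc
  have hc0 : c ≠ 0 := by intro h; rw [h] at hcos; norm_num at hcos
  have hy0 : Real.Gamma y ≠ 0 := (Real.Gamma_pos_of_pos (by positivity)).ne'
  have hpi := Real.pi_ne_zero
  have hG0 : Real.Gamma (1 - y) ≠ 0 := by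
    intro h
    rw [h, mul_zero] at hG
    exact div_ne_zero hpi hc0 hG.symm
  rw [eq_div_iff hc0] at hG
  field_simp
  linear_combination -hG

/-- The Abel moments of `J_ν` vanish when `k - ν` is odd and positive. -/
theorem besselMoment_eq_zero {ν k m : ℕ} (hk : k = ν + 2 * m + 1) : besselMoment ν k = 0 := by
  rw [besselMoment]
  have : ((ν : ℝ) - k + 1) / 2 = -(m : ℝ) := by rw [hk]; push_cast; ring
  rw [this, Real.Gamma_neg_nat_eq_zero, div_zero, mul_zero]

/-! ### Expansion of the quadrature rule -/

/-- The sum `∑_j w_j x_j^{(k - κ) / 2}` over the Gaussian nodes. -/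
noncomputable def gaussSum (n μ ν k : ℕ) : ℝ :=
  ∑ x ∈ gaussNodes (weightFun μ ν) n,
    gaussWeight (weightFun μ ν) n x * x ^ (((k : ℝ) - kappa μ ν) / 2)

theorem factorial_mul_boundaryWeight (n μ ν k : ℕ) :
    (k.factorial : ℝ) * boundaryWeight n μ ν k = besselMoment ν k -
      2 / Real.pi * Real.cos (((k : ℝ) - ν) * Real.pi / 2) * gaussSum n μ ν k := by
  have : (k.factorial : ℝ) ≠ 0 := by exact_mod_cast k.factorial_ne_zero
  rw [boundaryWeight, gaussSum, besselMoment]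
  field_simp

/-- The Gaussian part of the rule reproduces the Abel moments of `J_ν` from degree `μ` on. -/
theorem besselMoment_eq_gaussSum {n μ ν d k : ℕ} (h : ν ≤ μ)
    (hκ : kappa μ ν = ((ν + 2 * d : ℕ) : ℝ))
    (hd : ∀ x, weightFun μ ν x =
      besselK ν (Real.sqrt x) / 2 * x ^ ((((ν + 2 * d : ℕ) : ℝ) - 1) / 2))
    (hdμ : ν + 2 * d ≤ μ + 1) (hk : μ ≤ k) (hk2 : k < ν + 2 * d + 4 * n) :
    besselMoment ν k =
      2 / Real.pi * Real.cos (((k : ℝ) - ν) * Real.pi / 2) * gaussSum n μ ν k := by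
  have hw := isPosWeight_weightFun h
  rcases Nat.even_or_odd' (k - ν) with ⟨m, hm | hm⟩
  -- From `2m = k - ν ≥ μ - ν ≥ 2d - 1` one gets `m ≥ d`; the upper bound on `k` becomes `l < 2n`,
  -- the exactness range of the Gaussian rule.
  · obtain ⟨l, rfl⟩ : ∃ l, m = d + l := ⟨m - d, by omega⟩
    have e : k = ν + 2 * (d + l) := by omega
    subst e
    rw [besselMoment_eq_integral hd, ← hw.sum_gaussWeight_pow (n := n) (by omega), gaussSum]
    congr 1
    refine Finset.sum_congr rfl fun x _ => ?_
    rw [hκ, ← Real.rpow_natCast]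
    congr 2
    push_cast
    ring
  -- For odd `μ - ν`, the index `k = μ = κ - 1` falls here, so it needs no boundary term.
  · have e : k = ν + 2 * m + 1 := by omega
    have hc : Real.cos (((k : ℝ) - ν) * Real.pi / 2) = 0 := by
      rw [Real.cos_eq_zero_iff]
      exact ⟨m, by rw [e]; push_cast; ring⟩
    rw [besselMoment_eq_zero e, hc, mul_zero, zero_mul]

/-- The phases attached to the nodes `±i√x` combine on `z^k` into the cosine that appears in the
boundary weights and in the moment identity. -/
theorem exp_mul_I_pow_add (ν k : ℕ) :
    Complex.exp (-(ν * Real.pi * Complex.I / 2)) * Complex.I ^ k +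
      Complex.exp (ν * Real.pi * Complex.I / 2) * (-Complex.I) ^ k =
      ((2 * Real.cos (((k : ℝ) - ν) * Real.pi / 2) : ℝ) : ℂ) := by
  have h1 : Complex.I ^ k = Complex.exp (k * (Real.pi / 2 * Complex.I)) := by
    rw [Complex.exp_nat_mul, Complex.exp_pi_div_two_mul_I]
  have h2 : (-Complex.I) ^ k = Complex.exp (k * (-Real.pi / 2 * Complex.I)) := by
    rw [Complex.exp_nat_mul, Complex.exp_neg_pi_div_two_mul_I]
  rw [h1, h2, ← Complex.exp_add, ← Complex.exp_add, Complex.ofReal_mul, Complex.ofReal_cos,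
    Complex.cos]
  push_cast
  ring_nf

/-- The contribution of the node `x` to the quadrature rule. -/
noncomputable def nodeValue (ν : ℕ) (f : ℂ → ℂ) (ω x : ℝ) : ℂ :=
  Complex.exp (-(ν * Real.pi * Complex.I / 2)) * f (Complex.I * (Real.sqrt x : ℂ) / (ω : ℂ)) +
    Complex.exp (ν * Real.pi * Complex.I / 2) * f (-(Complex.I * (Real.sqrt x : ℂ)) / (ω : ℂ))

theorem nodeValue_taylorSum (ν : ℕ) (f : ℂ → ℂ) (N : ℕ) (ω x : ℝ) :
    nodeValue ν (taylorSum f N) ω x = ∑ k ∈ Finset.range N,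
      iteratedDeriv k f 0 / k.factorial / (ω : ℂ) ^ k *
        ((2 * Real.cos (((k : ℝ) - ν) * Real.pi / 2) * Real.sqrt x ^ k : ℝ) : ℂ) := by
  rw [nodeValue, taylorSum, taylorSum, Finset.mul_sum, Finset.mul_sum, ← Finset.sum_add_distrib]
  refine Finset.sum_congr rfl fun k _ => ?_
  rw [Complex.ofReal_mul, ← exp_mul_I_pow_add, div_pow, div_pow, ← neg_mul, mul_pow, mul_pow]
  push_cast
  ring

/-- As `ω → ∞` the two nodes tend to `0` along the imaginary axis, so analyticity of `f` at `0` is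
all that is needed. -/
theorem nodeValue_remainder {f : ℂ → ℂ} (hf : AnalyticAt ℂ f 0) (ν N : ℕ) (x : ℝ) :
    (fun ω : ℝ => nodeValue ν f ω x - nodeValue ν (taylorSum f N) ω x)
      =O[atTop] fun ω : ℝ => (ω ^ N)⁻¹ := by
  have key : ∀ c : ℂ, (fun ω : ℝ => f (c / ω) - taylorSum f N (c / ω))
      =O[atTop] fun ω : ℝ => (ω ^ N)⁻¹ := by
    intro c
    have hlim : Tendsto (fun ω : ℝ => c / (ω : ℂ)) atTop (𝓝 0) := by
      rw [tendsto_zero_iff_norm_tendsto_zero]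
      simp only [norm_div, Complex.norm_real]
      exact tendsto_const_nhds.div_atTop (tendsto_norm_atTop_atTop)
    refine ((taylorSum_remainder hf N).comp_tendsto hlim).trans
      (IsBigO.of_bound (‖c‖ ^ N) (Eventually.of_forall fun ω => le_of_eq ?_))
    simp only [Function.comp_apply, norm_pow, norm_norm, norm_inv, norm_div, Complex.norm_real,
      div_pow]
    exact div_eq_mul_inv _ _
  refine (((key (Complex.I * (Real.sqrt x : ℂ))).const_mul_left
    (Complex.exp (-(ν * Real.pi * Complex.I / 2)))).add
    ((key (-(Complex.I * (Real.sqrt x : ℂ)))).const_mul_left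
    (Complex.exp (ν * Real.pi * Complex.I / 2)))).congr_left fun ω => ?_
  rw [nodeValue, nodeValue]
  ring

/-- On the Taylor polynomial with `κ + 4n` terms the rule reproduces every Abel moment exactly; only
the Taylor remainder at the Gaussian nodes is left, and the prefactor `1/ω` raises its order by one.
-/
theorem quadRule_expansion {n μ ν : ℕ} (h : ν ≤ μ) {d : ℕ}
    (hκ : kappa μ ν = ((ν + 2 * d : ℕ) : ℝ))
    (hd : ∀ x, weightFun μ ν x =
      besselK ν (Real.sqrt x) / 2 * x ^ ((((ν + 2 * d : ℕ) : ℝ) - 1) / 2))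
    (hdμ : ν + 2 * d ≤ μ + 1) (hμd : μ ≤ ν + 2 * d) {f : ℂ → ℂ} (hf : AnalyticAt ℂ f 0) :
    (fun ω : ℝ => quadRule n μ ν f ω - ∑ k ∈ Finset.range (ν + 2 * d + 4 * n),
      iteratedDeriv k f 0 / k.factorial * besselMoment ν k / (ω : ℂ) ^ (k + 1))
      =O[atTop] fun ω : ℝ => (ω ^ (ν + 2 * d + 4 * n + 1))⁻¹ := by
  set N := ν + 2 * d + 4 * n with hN
  have hw := isPosWeight_weightFun h
  set W : ℝ → ℂ := fun x =>
    ((gaussWeight (weightFun μ ν) n x * x ^ (-kappa μ ν / 2) / Real.pi : ℝ) : ℂ) with hW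
  have hnode : ∀ ω : ℝ, ∑ x ∈ gaussNodes (weightFun μ ν) n, W x * nodeValue ν (taylorSum f N) ω x =
      ∑ k ∈ Finset.range N, iteratedDeriv k f 0 / k.factorial / (ω : ℂ) ^ k *
        ((2 / Real.pi * Real.cos (((k : ℝ) - ν) * Real.pi / 2) * gaussSum n μ ν k : ℝ) : ℂ) := by
    intro ω
    simp only [nodeValue_taylorSum, Finset.mul_sum]
    rw [Finset.sum_comm]
    refine Finset.sum_congr rfl fun k _ => ?_
    rw [gaussSum, Finset.mul_sum, Complex.ofReal_sum, Finset.mul_sum]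
    refine Finset.sum_congr rfl fun x hx => ?_
    have hx0 := hw.pos_of_mem_gaussNodes hx
    have e : x ^ (((k : ℝ) - kappa μ ν) / 2) = x ^ (-kappa μ ν / 2) * Real.sqrt x ^ k := by
      rw [Real.sqrt_eq_rpow, ← Real.rpow_natCast, ← Real.rpow_mul hx0.le, ← Real.rpow_add hx0]
      congr 1
      ring
    rw [e, hW]
    push_cast
    ring
  have hboundary : ∀ ω : ℝ, ∑ k ∈ Finset.range μ,
      ((boundaryWeight n μ ν k : ℂ) / (ω : ℂ) ^ k) * iteratedDeriv k f 0 =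
      ∑ k ∈ Finset.range N, iteratedDeriv k f 0 / k.factorial / (ω : ℂ) ^ k *
        ((besselMoment ν k -
          2 / Real.pi * Real.cos (((k : ℝ) - ν) * Real.pi / 2) * gaussSum n μ ν k : ℝ) : ℂ) := by
    intro ω
    -- The boundary sum may be extended from `μ` to `N` terms because the defect it corrects
    -- vanishes for `k ≥ μ`.
    rw [← Finset.sum_subset (Finset.range_subset_range.2 (show μ ≤ N by omega))]
    · refine Finset.sum_congr rfl fun k _ => ?_
      have : (k.factorial : ℂ) ≠ 0 := by exact_mod_cast k.factorial_ne_zero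
      rw [← factorial_mul_boundaryWeight]
      push_cast
      field_simp
    · intro k hk hk2
      rw [Finset.mem_range] at hk hk2
      rw [besselMoment_eq_gaussSum h hκ hd hdμ (not_lt.1 hk2) hk, sub_self, Complex.ofReal_zero,
        mul_zero]
  have e : ∀ᶠ ω : ℝ in atTop, (ω⁻¹ : ℂ) * ∑ x ∈ gaussNodes (weightFun μ ν) n,
      W x * (nodeValue ν f ω x - nodeValue ν (taylorSum f N) ω x) =
      quadRule n μ ν f ω - ∑ k ∈ Finset.range N,
        iteratedDeriv k f 0 / k.factorial * besselMoment ν k / (ω : ℂ) ^ (k + 1) := by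
    filter_upwards [eventually_gt_atTop 0] with ω hω
    have hωC : (ω : ℂ) ≠ 0 := by exact_mod_cast hω.ne'
    have hq : quadRule n μ ν f ω = (ω⁻¹ : ℂ) * ((∑ k ∈ Finset.range μ,
        ((boundaryWeight n μ ν k : ℂ) / (ω : ℂ) ^ k) * iteratedDeriv k f 0) +
        ∑ x ∈ gaussNodes (weightFun μ ν) n, W x * nodeValue ν f ω x) := by
      rw [quadRule, one_div]
      rfl
    simp only [mul_sub, Finset.sum_sub_distrib]
    rw [hq, hnode, hboundary]
    have e1 : ∑ k ∈ Finset.range N,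
        iteratedDeriv k f 0 / k.factorial * besselMoment ν k / (ω : ℂ) ^ (k + 1) =
        (ω⁻¹ : ℂ) * (∑ k ∈ Finset.range N, iteratedDeriv k f 0 / k.factorial / (ω : ℂ) ^ k *
          ((besselMoment ν k -
          2 / Real.pi * Real.cos (((k : ℝ) - ν) * Real.pi / 2) * gaussSum n μ ν k : ℝ) : ℂ) +
          ∑ k ∈ Finset.range N, iteratedDeriv k f 0 / k.factorial / (ω : ℂ) ^ k *
        ((2 / Real.pi * Real.cos (((k : ℝ) - ν) * Real.pi / 2) * gaussSum n μ ν k : ℝ) : ℂ)) := by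
      rw [← Finset.sum_add_distrib, Finset.mul_sum]
      refine Finset.sum_congr rfl fun k _ => ?_
      rw [← mul_add, ← Complex.ofReal_add, sub_add_cancel, pow_succ]
      field_simp
    rw [e1]
    ring
  refine IsBigO.congr' ?_ e EventuallyEq.rfl
  have h1 : (fun ω : ℝ => (ω⁻¹ : ℂ)) =O[atTop] fun ω : ℝ => ω⁻¹ :=
    IsBigO.of_bound 1 (Eventually.of_forall fun ω => by simp)
  refine (h1.mul (IsBigO.fun_sum fun x _ =>
    (nodeValue_remainder hf ν N x).const_mul_left (W x))).congr_right fun ω => ?_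
  rw [pow_succ, mul_inv, mul_comm]

end HankelQuadrature

/-! ### Comparison of the two expansions -/

open HankelQuadrature
theorem mainTheorem3 (n μ ν : ℕ) (hn : 1 ≤ n) (hνμ : ν ≤ μ)
    (f : ℂ → ℂ)
    (hf : AnalyticOnNhd ℂ f {z : ℂ | 0 < z.re})
    (hf0 : AnalyticAt ℂ f 0)
    (σ K R : ℝ)
    (hgrowth : ∀ z : ℂ, 0 < z.re → R ≤ ‖z‖ → ‖f z‖ ≤ K * ‖z‖ ^ σ) :
    (∀ ω : ℝ, 0 < ω → HasAbelIntegral (hankelIntegrand ν f ω) (hankelTransform ν f ω)) ∧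
    (Even (μ - ν) →
      (fun ω : ℝ => hankelTransform ν f ω - quadRule n μ ν f ω)
        =O[atTop] fun ω : ℝ => ω ^ (-(4 * (n : ℤ)) - (μ : ℤ) - 1)) ∧
    (Odd (μ - ν) →
      (fun ω : ℝ => hankelTransform ν f ω - quadRule n μ ν f ω)
        =O[atTop] fun ω : ℝ => ω ^ (-(4 * (n : ℤ)) - (μ : ℤ) - 2)) := by
  have hF : HankelAdmissible f := ⟨hf, hf0, σ, K, R, hgrowth⟩
  obtain ⟨d, hκ, hdμ, hd⟩ := exists_kappa hνμ
  have hle : ν + 2 * d ≤ μ + 1 ∧ μ ≤ ν + 2 * d := by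
    rw [hdμ]; split_ifs <;> omega
  -- The two truncated series are identical, so they cancel in the difference; the parity enters
  -- only through the value of `ν + 2d`.
  have hO : (fun ω : ℝ => hankelTransform ν f ω - quadRule n μ ν f ω)
      =O[atTop] fun ω : ℝ => (ω ^ (ν + 2 * d + 4 * n + 1))⁻¹ :=
    ((hF.hankelTransform_expansion ν (ν + 2 * d + 4 * n)).sub
      (quadRule_expansion (n := n) hνμ hκ hd hle.1 hle.2 hf0)).congr_left fun ω => by ring
  refine ⟨fun ω hω => ?_, fun he => ?_, fun ho => ?_⟩
  · rw [hF.hankelTransform_eq ν hω]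
    exact hF.hasAbelIntegral ν hω
  · rw [if_pos he] at hdμ
    refine hO.congr_right fun ω => ?_
    rw [← zpow_natCast, ← zpow_neg, hdμ]
    congr 1
    push_cast
    ring
  · rw [if_neg (Nat.not_even_iff_odd.2 ho)] at hdμ
    refine hO.congr_right fun ω => ?_
    rw [← zpow_natCast, ← zpow_neg, hdμ]
    congr 1
    push_cast
    ring
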